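/- **Theorem 4.1 ($L^2$ stability).** Let $\alpha,\beta\in(1,2]$, $\Omega=(a,b)\times(c,d)$ with $a<b$, $c<d$, and let $\overline\Omega=\bigcup_{k=1}^K D^k$ be a conforming triangulation into nonoverlapping nondegenerate closed triangles. Let $\Gamma$ be the union of all edges, $\Gamma_i$ that of the internal edges, $\Gamma_b=\partial\Omega$ that of the external ones, and for $N\ge 0$ let $V_h=\{v: v|_{D^k}\in P_N^2(D^k),\ k=1,\dots,K\}$, where $P_N^2$ denotes the polynomials in two variables of total degree at most $N$. Inner products over $\Omega$ and gradients are taken elementwise. For $s>0$ let ${_a}D_x^{-s}g(x)=\frac1{\Gamma(s)}\int_a^x(x-\xi)^{s-1}g(\xi)\,d\xi$, and ${_a}D_x^{0}g=g$; elements of $V_h$ are extended by $0$ outside $\Omega$. For $s\ge0$ let $\|g\|_{H^{-s}}=\big\||\omega|^{-s}\widehat g\big\|_{L^2(\mathbb R)}$, where $\widehat g(\omega)=(2\pi)^{-1/2}\int_{\mathbb R} e^{-i\omega x}g(x)\,dx$. On an internal edge with adjacent elements $D^\pm$ and outward unit normals $\mathbf n^\pm$ put $[v]=\mathbf n^+v^++\mathbf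 n^-v^-$, $[\mathbf w]=\mathbf n^+\!\cdot\mathbf w^++\mathbf n^-\!\cdot\mathbf w^-$, and use the central fluxes $\widehat u=\frac{u^++u^-}2$, $\widehat{\mathbf q}=\frac{\mathbf q^++\mathbf q^-}2$; on an external edge put $[v]=\mathbf n v$, $\widehat u=0$ and $\widehat{\mathbf q}=\mathbf q$. For $\mathbf p=(p^x,p^y)$ and $\mathbf q=(q^x,q^y)$ define $$\begin{aligned}B(u,\mathbf p,\mathbf q;v,\boldsymbol\phi,\boldsymbol\pi)=&\int_0^T\Big[\big(\tfrac{\partial u}{\partial t},v\big)+(\mathbf q,\nabla v)+(\mathbf q,\boldsymbol\phi)-\big(({_a}D_x^{\alpha-2}p^x,\,{_c}D_y^{\beta-2}p^y),\boldsymbol\phi\big)+(\mathbf p,\boldsymbol\pi)+(u,\nabla\!\cdot\boldsymbol\pi)\Big]dt\\&-\int_0^T\Big(\oint_\Gamma\widehat{\mathbf q}\cdot[v]\,ds+\oint_{\Gamma_i}\widehat u\,[\boldsymbol\pi]\,ds\Big)dt.\end{aligned}$$ A solution of the semidiscrete LDG scheme with central fluxes for $$\partial_tu=\partial_x\,{_a}D_x^{\alpha-2}\partial_xu+\partial_y\,{_c}D_y^{\beta-2}\partial_yu+f\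 \text{ in }\Omega\times(0,T),\qquad u=0\ \text{ on }\partial\Omega\times(0,T),$$ is a triple $(u_h,\mathbf p_h,\mathbf q_h)\in X:=H^1(0,T;V_h)\times(L^2(0,T;V_h))^2\times(L^2(0,T;V_h))^2$ with $B(u_h,\mathbf p_h,\mathbf q_h;v,\boldsymbol\phi,\boldsymbol\pi)=\int_0^T(f,v)\,dt$ for all $(v,\boldsymbol\phi,\boldsymbol\pi)\in X$; here $u_h$ is taken to be its continuous representative in time. Let $(u_h,\mathbf p_h,\mathbf q_h)$ and $(\widetilde u_h,\widetilde{\mathbf p}_h,\widetilde{\mathbf q}_h)$ be two solutions of the scheme with the same $f$, not necessarily with the same initial values, and let $e_{u_h}=u_h-\widetilde u_h$, $e_{\mathbf p_h}=\mathbf p_h-\widetilde{\mathbf p}_h=(e_{p_h^x},e_{p_h^y})$. Then for all $t\in(0,T)$ the scheme is $L^2$ stable, i.e. $\|e_{u_h}(\cdot,t)\|_{L^2(\Omega)}\le\|e_{u_h}(\cdot,0)\|_{L^2(\Omega)}$, and $$\begin{aligned}\|e_{u_h}(\cdot,t)\|^2_{L^2(\Omega)}=\|e_{u_h}(\cdot,0)\|^2_{L^2(\Omega)}&-2\cos\big((\tfrac\alpha2-1)\pi\big)\int_0^t\!\int_c^d\|e_{p_h^x}(\cdot,y,\tau)\|^2_{H^{\alpha/2-1}}\,dy\,d\tau\\&-2\cos\big((\tfrac\beta2-1)\pi\big)\int_0^t\!\int_a^b\|e_{p_h^y}(x,\cdot,\tau)\|^2_{H^{\beta/2-1}}\,dx\,d\tau,\end{aligned}$$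 where both double integrals are finite. -/

import Mathlib

open MeasureTheory

namespace LDG

/-- Euclidean scalar product of two vectors of the plane. -/
def dot (v w : ℝ × ℝ) : ℝ := v.1 * w.1 + v.2 * w.2

/-- Euclidean length of a vector of the plane. -/
noncomputable def len (v : ℝ × ℝ) : ℝ := Real.sqrt (dot v v)

/-! ### Fractional calculus in one variable -/

/-- The left fractional integral `ₐD_x^{-s} g` of order `s ≥ 0`, based at `a`; order `0` is the
identity. -/
noncomputable def leftFracInt (a s : ℝ) (g : ℝ → ℝ) (x : ℝ) : ℝ :=
  if s = 0 then g x
  else (1 / Real.Gamma s) * ∫ ξ in a..x, (x - ξ) ^ (s - 1) * g ξ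

/-- The unitary Fourier transform `ĝ(ω) = (2π)^{-1/2} ∫ e^{-iωx} g(x) dx`. -/
noncomputable def fourierHat (g : ℝ → ℝ) (ω : ℝ) : ℂ :=
  ((1 / Real.sqrt (2 * Real.pi) : ℝ) : ℂ) *
    ∫ x : ℝ, Complex.exp (-(Complex.I * (ω : ℂ) * (x : ℂ))) * (g x : ℂ)

/-- The norm `‖g‖_{H^{-s}(ℝ)} = ‖ |ω|^{-s} ĝ ‖_{L²(ℝ)}`, as an extended nonnegative real. -/
noncomputable def negSobolevNorm (s : ℝ) (g : ℝ → ℝ) : ENNReal :=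
  eLpNorm (fun ω : ℝ => ((|ω| ^ (-s) : ℝ) : ℂ) * fourierHat g ω) 2 volume

/-! ### Triangulations -/

/-- A conforming triangulation of the rectangle `Ω = (a,b) × (c,d)` by `K` triangles. -/
structure Mesh (K : ℕ) (a b c d : ℝ) where
  /-- the three vertices of each element -/
  vert : Fin K → Fin 3 → ℝ × ℝ
  /-- the elements are genuine triangles -/
  nondegenerate : ∀ k, AffineIndependent ℝ (vert k)
  /-- the elements fill the domain -/
  fills : (⋃ k, convexHull ℝ (Set.range (vert k))) = Set.Icc a b ×ˢ Set.Icc c d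
  /-- different elements do not overlap -/
  nonoverlapping : ∀ k l, k ≠ l →
    Disjoint (interior (convexHull ℝ (Set.range (vert k))))
      (interior (convexHull ℝ (Set.range (vert l))))
  /-- two different elements meet in nothing, a common vertex, or a common edge -/
  conforming : ∀ k l, k ≠ l →
    convexHull ℝ (Set.range (vert k)) ∩ convexHull ℝ (Set.range (vert l)) =
      convexHull ℝ (Set.range (vert k) ∩ Set.range (vert l))

/-- The discontinuous space `V_h = ⨁ₖ P_N(Dᵏ)`: one real polynomial in two variables of total
degree at most `N` on each of the `K` elements. -/
abbrev Vh (K N : ℕ) : Type := Fin K → MvPolynomial.restrictTotalDegree (Fin 2) ℝ N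

variable {K N : ℕ} {a b c d : ℝ}

/-- The value at `x` of the polynomial that `v` carries on the element `k`. -/
noncomputable def Vh.val (v : Vh K N) (k : Fin K) (x : ℝ × ℝ) : ℝ :=
  MvPolynomial.eval ![x.1, x.2] (v k : MvPolynomial (Fin 2) ℝ)

/-- The elementwise partial derivative of `v` in the direction `i` (`0` for `x`, `1` for `y`). -/
noncomputable def Vh.partialDeriv (i : Fin 2) (v : Vh K N) (k : Fin K) (x : ℝ × ℝ) : ℝ :=
  MvPolynomial.eval ![x.1, x.2] (MvPolynomial.pderiv i (v k : MvPolynomial (Fin 2) ℝ))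

namespace Mesh

/-- The closed triangle `Dᵏ`. -/
def elem (M : Mesh K a b c d) (k : Fin K) : Set (ℝ × ℝ) := convexHull ℝ (Set.range (M.vert k))

/-- The broken inner product `(F, G)_Ω = ∑ₖ ∫_{Dᵏ} F G`. -/
noncomputable def inner (M : Mesh K a b c d) (F G : Fin K → ℝ × ℝ → ℝ) : ℝ :=
  ∑ k, ∫ x in M.elem k, F k x * G k x

/-- The norm of `L²(Ω)` on `V_h`. -/
noncomputable def normL2 (M : Mesh K a b c d) (v : Vh K N) : ℝ :=
  Real.sqrt (M.inner v.val v.val)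

/-- `v ∈ V_h` as a function on the plane: the given polynomial inside each element, zero outside
`Ω`.  On the edges, a null set, the value is zero. -/
noncomputable def toFun (M : Mesh K a b c d) (v : Vh K N) (x : ℝ × ℝ) : ℝ :=
  ∑ k, Set.indicator (interior (M.elem k)) (v.val k) x

/-- The fractional integral `∂^{-s} v / ∂x^{-s} = ₐD_x^{-s} v(·, y)`, `s ≥ 0`. -/
noncomputable def fracIntX (M : Mesh K a b c d) (s : ℝ) (v : Vh K N) (x : ℝ × ℝ) : ℝ :=
  leftFracInt a s (fun ξ => M.toFun v (ξ, x.2)) x.1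

/-- The fractional integral `∂^{-s} v / ∂y^{-s} = _cD_y^{-s} v(x, ·)`, `s ≥ 0`. -/
noncomputable def fracIntY (M : Mesh K a b c d) (s : ℝ) (v : Vh K N) (x : ℝ × ℝ) : ℝ :=
  leftFracInt c s (fun η => M.toFun v (x.1, η)) x.2

/-! ### Edges, traces, fluxes

A side `(k, i)` is the edge of the element `k` opposite to its vertex `i`. -/

/-- The first endpoint of a side. -/
def sideA (M : Mesh K a b c d) (e : Fin K × Fin 3) : ℝ × ℝ := M.vert e.1 (e.2 + 1)

/-- The second endpoint of a side. -/
def sideB (M : Mesh K a b c d) (e : Fin K × Fin 3) : ℝ × ℝ := M.vert e.1 (e.2 + 2)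

/-- The integral of `g` over a side with respect to arc length. -/
noncomputable def sideInt (M : Mesh K a b c d) (e : Fin K × Fin 3) (g : ℝ × ℝ → ℝ) : ℝ :=
  len (M.sideB e - M.sideA e) *
    ∫ s in (0 : ℝ)..1, g (M.sideA e + s • (M.sideB e - M.sideA e))

/-- A vector orthogonal to a side (not normalized, not oriented). -/
def sidePerp (M : Mesh K a b c d) (e : Fin K × Fin 3) : ℝ × ℝ :=
  ((M.sideB e - M.sideA e).2, -(M.sideB e - M.sideA e).1)

/-- The unit normal of the side `(k, i)` that points out of the element `k`, i.e. away from its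
opposite vertex. -/
noncomputable def normal (M : Mesh K a b c d) (e : Fin K × Fin 3) : ℝ × ℝ :=
  (-(Real.sign (dot (M.sidePerp e) (M.vert e.1 e.2 - M.sideA e))) / len (M.sidePerp e)) •
    M.sidePerp e

/-- The sides `e` and `e'` of two different elements are one and the same edge. -/
def SameEdge (M : Mesh K a b c d) (e e' : Fin K × Fin 3) : Prop :=
  e.1 ≠ e'.1 ∧ ({M.sideA e, M.sideB e} : Set (ℝ × ℝ)) = {M.sideA e', M.sideB e'}

open Classical in
/-- The ordered pairs of sides that form an internal edge.  Each edge of `Γ_i` occurs twice here,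
once for each labelling of its two elements by `-` and `+`. -/
noncomputable def internalPairs (M : Mesh K a b c d) :
    Finset ((Fin K × Fin 3) × (Fin K × Fin 3)) :=
  Finset.univ.filter fun e => M.SameEdge e.1 e.2

open Classical in
/-- The external edges `Γ_b`: those that belong to one element only. -/
noncomputable def externalSides (M : Mesh K a b c d) : Finset (Fin K × Fin 3) :=
  Finset.univ.filter fun e => ∀ e', ¬ M.SameEdge e e'

/-- The integral over `Γ_i` of a quantity `g` that depends on an internal edge, given as the pair
of its sides `(e⁻, e⁺)`, and on a point of it; for `g` symmetric in the two sides. -/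
noncomputable def intInternal (M : Mesh K a b c d)
    (g : Fin K × Fin 3 → Fin K × Fin 3 → ℝ × ℝ → ℝ) : ℝ :=
  (1 / 2) * ∑ e ∈ M.internalPairs, M.sideInt e.1 (g e.1 e.2)

/-- The integral over `Γ_b`. -/
noncomputable def intExternal (M : Mesh K a b c d)
    (g : Fin K × Fin 3 → ℝ × ℝ → ℝ) : ℝ :=
  ∑ e ∈ M.externalSides, M.sideInt e (g e)

/-- The trace of a vector field `w ∈ (V_h)²` from the element that carries the side `e`. -/
noncomputable def trace (_M : Mesh K a b c d) (w : Vh K N × Vh K N) (e : Fin K × Fin 3)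
    (x : ℝ × ℝ) : ℝ × ℝ := (w.1.val e.1 x, w.2.val e.1 x)

/-- The central flux `(u⁺ + u⁻)/2` on the internal edge `(e⁻, e⁺)`.  On external edges the flux
of `u` is `0`. -/
noncomputable def fluxU (_M : Mesh K a b c d) (u : Vh K N) (e e' : Fin K × Fin 3)
    (x : ℝ × ℝ) : ℝ := (u.val e'.1 x + u.val e.1 x) / 2

/-- The central flux `(q⁺ + q⁻)/2` on the internal edge `(e⁻, e⁺)`.  On external edges the flux
of `q` is the trace of `q`. -/
noncomputable def fluxQ (M : Mesh K a b c d) (q : Vh K N × Vh K N) (e e' : Fin K × Fin 3)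
    (x : ℝ × ℝ) : ℝ × ℝ := (1 / 2 : ℝ) • (M.trace q e' x + M.trace q e x)

/-- The jump `[v] = n⁺ v⁺ + n⁻ v⁻` on the internal edge `(e⁻, e⁺)`. -/
noncomputable def jump (M : Mesh K a b c d) (v : Vh K N) (e e' : Fin K × Fin 3)
    (x : ℝ × ℝ) : ℝ × ℝ := v.val e'.1 x • M.normal e' + v.val e.1 x • M.normal e

/-- The jump `[w] = n⁺ · w⁺ + n⁻ · w⁻` on the internal edge `(e⁻, e⁺)`. -/
noncomputable def jumpVec (M : Mesh K a b c d) (w : Vh K N × Vh K N) (e e' : Fin K × Fin 3)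
    (x : ℝ × ℝ) : ℝ := dot (M.normal e') (M.trace w e' x) + dot (M.normal e) (M.trace w e x)

/-- `∮_Γ q̂ · [v] ds`, with `q̂` the central flux on `Γ_i` and `q̂ = q`, `[v] = n v` on `Γ_b`. -/
noncomputable def fluxTermQ (M : Mesh K a b c d) (q : Vh K N × Vh K N) (v : Vh K N) : ℝ :=
  M.intInternal (fun e e' x => dot (M.fluxQ q e e' x) (M.jump v e e' x)) +
    M.intExternal (fun e x => dot (M.trace q e x) (v.val e.1 x • M.normal e))

/-- `∮_{Γ_i} û [w] ds` with the central flux `û`. -/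
noncomputable def fluxTermU (M : Mesh K a b c d) (u : Vh K N) (w : Vh K N × Vh K N) : ℝ :=
  M.intInternal (fun e e' x => M.fluxU u e e' x * M.jumpVec w e e' x)

end Mesh

/-! ### Time dependent functions and the scheme -/

/-- `v ∈ L²(0,T;V_h)`.  The space `V_h` has finite dimension, so this says that all coefficients
are square integrable in time. -/
def MemL2Vh (T : ℝ) (v : ℝ → Vh K N) : Prop :=
  ∀ k m, MemLp (fun t => MvPolynomial.coeff m (v t k : MvPolynomial (Fin 2) ℝ)) 2
    (volume.restrict (Set.Ioo 0 T))

/-- `v ∈ L²(0,T;(V_h)²)`. -/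
def MemL2Vh2 (T : ℝ) (w : ℝ → Vh K N × Vh K N) : Prop :=
  MemL2Vh T (fun t => (w t).1) ∧ MemL2Vh T (fun t => (w t).2)

/-- `v ∈ H¹(0,T;V_h)` (the continuous representative): the coefficients are absolutely continuous
on `[0,T]` with derivatives in `L²(0,T)`. -/
def MemH1Vh (T : ℝ) (v : ℝ → Vh K N) : Prop :=
  ∀ k m,
    AbsolutelyContinuousOnInterval
      (fun t => MvPolynomial.coeff m (v t k : MvPolynomial (Fin 2) ℝ)) 0 T ∧
    MemLp (deriv fun t => MvPolynomial.coeff m (v t k : MvPolynomial (Fin 2) ℝ)) 2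
      (volume.restrict (Set.Ioo 0 T))

/-- The time derivative `∂v/∂t (x, t)`, `x ∈ Dᵏ`. -/
noncomputable def timeDeriv (v : ℝ → Vh K N) (t : ℝ) (k : Fin K) (x : ℝ × ℝ) : ℝ :=
  deriv (fun τ => (v τ).val k x) t

namespace Mesh

/-- The discrete bilinear form `B(u, p, q; v, φ, π)` of the scheme, with central fluxes. -/
noncomputable def formB (M : Mesh K a b c d) (α β T : ℝ)
    (u : ℝ → Vh K N) (p q : ℝ → Vh K N × Vh K N)
    (v : ℝ → Vh K N) (φ π : ℝ → Vh K N × Vh K N) : ℝ :=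
  (∫ t in (0 : ℝ)..T, M.inner (timeDeriv u t) (v t).val)
  + (∫ t in (0 : ℝ)..T, (M.inner (q t).1.val ((v t).partialDeriv 0)
      + M.inner (q t).2.val ((v t).partialDeriv 1)))
  + (∫ t in (0 : ℝ)..T, (M.inner (q t).1.val (φ t).1.val + M.inner (q t).2.val (φ t).2.val))
  - (∫ t in (0 : ℝ)..T, (M.inner (fun _ => M.fracIntX (2 - α) (p t).1) (φ t).1.val
      + M.inner (fun _ => M.fracIntY (2 - β) (p t).2) (φ t).2.val))
  + (∫ t in (0 : ℝ)..T, (M.inner (p t).1.val (π t).1.val + M.inner (p t).2.val (π t).2.val))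
  + (∫ t in (0 : ℝ)..T, M.inner (u t).val
      (fun k x => (π t).1.partialDeriv 0 k x + (π t).2.partialDeriv 1 k x))
  - ∫ t in (0 : ℝ)..T, (M.fluxTermQ (q t) (v t) + M.fluxTermU (u t) (π t))

/-- `(u, p, q)` solves the semidiscrete scheme on `(0,T)` with source term `f(x, t)`. -/
structure IsSolution (M : Mesh K a b c d) (α β T : ℝ) (f : ℝ × ℝ → ℝ → ℝ)
    (u : ℝ → Vh K N) (p q : ℝ → Vh K N × Vh K N) : Prop where
  memU : MemH1Vh T u
  memP : MemL2Vh2 T p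
  memQ : MemL2Vh2 T q
  equation : ∀ (v : ℝ → Vh K N) (φ π : ℝ → Vh K N × Vh K N),
    MemH1Vh T v → MemL2Vh2 T φ → MemL2Vh2 T π →
      M.formB α β T u p q v φ π =
        ∫ t in (0 : ℝ)..T, M.inner (fun _ x => f x t) (v t).val

/-- `∫₀ᵗ ∫_c^d ‖w(·, y, τ)‖²_{H^{-s}} dy dτ`. -/
noncomputable def negNormSqX (M : Mesh K a b c d) (s t : ℝ) (w : ℝ → Vh K N) : ENNReal :=
  ∫⁻ τ in Set.Ioo 0 t, ∫⁻ y in Set.Ioo c d,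
    negSobolevNorm s (fun x => M.toFun (w τ) (x, y)) ^ 2

/-- `∫₀ᵗ ∫_a^b ‖w(x, ·, τ)‖²_{H^{-s}} dx dτ`. -/
noncomputable def negNormSqY (M : Mesh K a b c d) (s t : ℝ) (w : ℝ → Vh K N) : ENNReal :=
  ∫⁻ τ in Set.Ioo 0 t, ∫⁻ x in Set.Ioo a b,
    negSobolevNorm s (fun y => M.toFun (w τ) (x, y)) ^ 2

end Mesh

end LDG

/-!
The difference of two solutions solves the scheme with `f = 0`, and testing it with
`(u, -p, q)` yields an energy identity. Two facts make the remaining terms explicit.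

* *Boundary terms.* The divergence theorem on each triangle (`divergence_triangle`) turns
  `(q, ∇u) + (u, ∇·q)` into the sum over all sides of the integrals of `u q · n`. Because elements
  do not overlap, a side has at most one neighbour, and the two outward normals there are
  opposite (`Mesh.SameEdge.unique`, `Mesh.SameEdge.normal_eq_neg`). With central fluxes the sum is
  therefore exactly the two flux terms (`Mesh.fluxTermQ_add_fluxTermU`).
* *Fractional terms.* For `0 ≤ s < 1` and a bounded function `g` supported in `[a,b]` and
  continuous almost everywhere, `(ₐD_x^{-s} g, g) = cos (sπ/2) ‖g‖²_{H^{-s/2}}`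
  (`negSobolevNorm_sq`). Symmetrizing the kernel gives half the energy of the Riesz kernel
  `|x - ξ|^{s-1}`. That kernel is a superposition of the Gaussians `e^{-l (x-ξ)²}`, whose energies
  are Gaussian averages of `|ĝ|²` (`gaussian_fourierHat`). The superposition of the latter is a
  multiple of `|ω|^{-s}`, with all interchanges justified by absolute convergence on the side of
  `x` and by positivity on the side of `ω`; reflection and duplication for the Gamma function
  identify the constant (`riesz_constant`). For `s = 0` this is Plancherel's formula, obtained from
  the same Gaussian identity as `l → ∞`. Integration over the slices of `Ω` gives the energies of
  `p^x` and `p^y` (`Mesh.fracFormX_self`, `Mesh.fracFormY_self`).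

The scheme holds only after integration in time. All its terms are bilinear on finite-dimensional
spaces, so test functions `ψ(t) w` with smooth `ψ` localize it: at almost every time it holds for
all test functions at once (`ae_residual_eq_zero`), in particular for `(u, -p, q)`, where it reads
`½ d/dt ‖u‖² = -(ₐD_x^{α-2} p^x, p^x) - (_cD_y^{β-2} p^y, p^y)`. The squared norm is absolutely
continuous, hence the integral of its derivative (`massForm_sub_eq`).
-/

namespace LDG

/-! ### The Gaussian identity and the constants -/

/-- `|ĝ|²` as a double integral, the form to which Fubini's theorem applies. -/
lemma normSq_fourierHat (g : ℝ → ℝ) (ω : ℝ) :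
    ((‖fourierHat g ω‖ ^ 2 : ℝ) : ℂ) = ((1 / (2 * Real.pi) : ℝ) : ℂ) *
      ∫ z : ℝ × ℝ, Complex.exp (Complex.I * ((z.2 - z.1 : ℝ) : ℂ) * (ω : ℂ)) *
        ((g z.1 * g z.2 : ℝ) : ℂ) := by
  have h1 : (starRingEnd ℂ) (∫ x : ℝ, Complex.exp (-(Complex.I * (ω : ℂ) * (x : ℂ))) * (g x : ℂ))
      = ∫ x : ℝ, Complex.exp (Complex.I * (ω : ℂ) * (x : ℂ)) * (g x : ℂ) := by
    rw [← integral_conj]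
    refine integral_congr_ae (Filter.Eventually.of_forall fun x => ?_)
    simp [← Complex.exp_conj]
  have h2 : (∫ z : ℝ × ℝ, Complex.exp (Complex.I * ((z.2 - z.1 : ℝ) : ℂ) * (ω : ℂ)) *
        ((g z.1 * g z.2 : ℝ) : ℂ)) =
      (∫ x : ℝ, Complex.exp (-(Complex.I * (ω : ℂ) * (x : ℂ))) * (g x : ℂ)) *
      ∫ x : ℝ, Complex.exp (Complex.I * (ω : ℂ) * (x : ℂ)) * (g x : ℂ) := by
    rw [← integral_prod_mul]
    refine integral_congr_ae (Filter.Eventually.of_forall fun z => ?_)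
    have : Complex.exp (Complex.I * ((z.2 - z.1 : ℝ) : ℂ) * (ω : ℂ)) =
        Complex.exp (-(Complex.I * (ω : ℂ) * (z.1 : ℂ))) *
          Complex.exp (Complex.I * (ω : ℂ) * (z.2 : ℂ)) := by
      rw [← Complex.exp_add]
      congr 1
      push_cast
      ring
    simp only [this]
    push_cast
    ring
  have h3 : (1 / Real.sqrt (2 * Real.pi)) * (1 / Real.sqrt (2 * Real.pi)) = 1 / (2 * Real.pi) := by
    rw [div_mul_div_comm, Real.mul_self_sqrt (by positivity), one_mul]
  rw [h2, ← h1, Complex.ofReal_pow, ← Complex.mul_conj', fourierHat, map_mul, Complex.conj_ofReal,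
    ← h3, Complex.ofReal_mul]
  ring

/-- The energy of a Gaussian kernel is a Gaussian average of `|ĝ|²`. -/
lemma gaussian_fourierHat {g : ℝ → ℝ} (hg : Integrable g) {l : ℝ} (hl : 0 < l) :
    ∫ ω : ℝ, Real.exp (-(1 / (4 * l)) * ω ^ 2) * ‖fourierHat g ω‖ ^ 2 =
      Real.sqrt (l / Real.pi) *
        ∫ z : ℝ × ℝ, Real.exp (-l * (z.1 - z.2) ^ 2) * (g z.1 * g z.2) := by
  have hb : 0 < 1 / (4 * l) := by positivity
  have hG : Integrable (fun z : ℝ × ℝ => g z.1 * g z.2) := hg.mul_prod hg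
  have key : ∫ ω : ℝ, ∫ z : ℝ × ℝ, ((Real.exp (-(1 / (4 * l)) * ω ^ 2) : ℝ) : ℂ) *
      (Complex.exp (Complex.I * ((z.2 - z.1 : ℝ) : ℂ) * (ω : ℂ)) * ((g z.1 * g z.2 : ℝ) : ℂ)) =
      ∫ z : ℝ × ℝ, ∫ ω : ℝ, ((Real.exp (-(1 / (4 * l)) * ω ^ 2) : ℝ) : ℂ) *
      (Complex.exp (Complex.I * ((z.2 - z.1 : ℝ) : ℂ) * (ω : ℂ)) * ((g z.1 * g z.2 : ℝ) : ℂ)) := by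
    apply integral_integral_swap
    have h1 : Integrable (fun y : ℝ × (ℝ × ℝ) => ((Real.exp (-(1 / (4 * l)) * y.1 ^ 2) : ℝ) : ℂ) *
        ((g y.2.1 * g y.2.2 : ℝ) : ℂ)) :=
      (integrable_exp_neg_mul_sq hb).ofReal.mul_prod hG.ofReal
    have h2 := h1.bdd_mul (c := 1) (f := fun y : ℝ × (ℝ × ℝ) =>
      Complex.exp (Complex.I * ((y.2.2 - y.2.1 : ℝ) : ℂ) * (y.1 : ℂ)))
      (by
        apply Continuous.aestronglyMeasurable
        fun_prop)
      (Filter.Eventually.of_forall fun y => by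
        rw [mul_assoc, ← Complex.ofReal_mul, mul_comm, Complex.norm_exp_ofReal_mul_I])
    refine h2.congr (Filter.Eventually.of_forall fun y => ?_)
    simp only [Function.uncurry]
    ring
  have inner : ∀ z : ℝ × ℝ, (∫ ω : ℝ, ((Real.exp (-(1 / (4 * l)) * ω ^ 2) : ℝ) : ℂ) *
      (Complex.exp (Complex.I * ((z.2 - z.1 : ℝ) : ℂ) * (ω : ℂ)) * ((g z.1 * g z.2 : ℝ) : ℂ))) =
      ((Real.sqrt (4 * l * Real.pi) * (Real.exp (-l * (z.1 - z.2) ^ 2) * (g z.1 * g z.2)) : ℝ)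
        : ℂ) := by
    intro z
    have h := fourierIntegral_gaussian (b := ((1 / (4 * l) : ℝ) : ℂ)) (by simpa using hb)
      ((z.2 - z.1 : ℝ) : ℂ)
    have e1 : ((Real.pi : ℂ) / ((1 / (4 * l) : ℝ) : ℂ)) ^ (1 / 2 : ℂ) =
        ((Real.sqrt (4 * l * Real.pi) : ℝ) : ℂ) := by
      rw [Real.sqrt_eq_rpow, Complex.ofReal_cpow (by positivity)]
      push_cast
      congr 1
      field_simp
    have e2 : Complex.exp (-((z.2 - z.1 : ℝ) : ℂ) ^ 2 / (4 * ((1 / (4 * l) : ℝ) : ℂ))) =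
        ((Real.exp (-l * (z.1 - z.2) ^ 2) : ℝ) : ℂ) := by
      have : (l : ℂ) ≠ 0 := by exact_mod_cast hl.ne'
      rw [Complex.ofReal_exp]
      congr 1
      push_cast
      field_simp
      ring
    rw [e1, e2] at h
    calc _ = ∫ ω : ℝ, (Complex.exp (Complex.I * ((z.2 - z.1 : ℝ) : ℂ) * (ω : ℂ)) *
        Complex.exp (-((1 / (4 * l) : ℝ) : ℂ) * (ω : ℂ) ^ 2)) * ((g z.1 * g z.2 : ℝ) : ℂ) := by
          congr 1
          ext ω
          push_cast
          ring
      _ = _ := by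
          rw [integral_mul_const, h]
          push_cast
          ring
  have hs : 1 / (2 * Real.pi) * Real.sqrt (4 * l * Real.pi) = Real.sqrt (l / Real.pi) := by
    have : l / Real.pi = (1 / (2 * Real.pi)) ^ 2 * (4 * l * Real.pi) := by
      field_simp
      ring
    rw [this, Real.sqrt_mul (sq_nonneg _), Real.sqrt_sq (by positivity)]
  rw [← Complex.ofReal_inj, ← integral_complex_ofReal]
  simp_rw [Complex.ofReal_mul _ (‖fourierHat g _‖ ^ 2), normSq_fourierHat, inner] at key ⊢
  rw [integral_complex_ofReal, integral_const_mul] at key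
  rw [← hs]
  have : ∀ ω : ℝ, ((Real.exp (-(1 / (4 * l)) * ω ^ 2) : ℝ) : ℂ) *
      (((1 / (2 * Real.pi) : ℝ) : ℂ) * ∫ z : ℝ × ℝ,
        Complex.exp (Complex.I * ((z.2 - z.1 : ℝ) : ℂ) * (ω : ℂ)) * ((g z.1 * g z.2 : ℝ) : ℂ)) =
      ((1 / (2 * Real.pi) : ℝ) : ℂ) * ∫ z : ℝ × ℝ, ((Real.exp (-(1 / (4 * l)) * ω ^ 2) : ℝ) : ℂ) *
      (Complex.exp (Complex.I * ((z.2 - z.1 : ℝ) : ℂ) * (ω : ℂ)) *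
        ((g z.1 * g z.2 : ℝ) : ℂ)) := by
    intro ω
    rw [integral_const_mul]
    ring
  simp_rw [this]
  rw [integral_const_mul, key]
  push_cast
  ring

lemma continuous_fourierHat {g : ℝ → ℝ} (hg : Integrable g) : Continuous (fourierHat g) := by
  unfold fourierHat
  refine continuous_const.mul ?_
  refine continuous_of_dominated (bound := fun x => ‖g x‖) (fun ω => ?_) (fun ω => ?_) hg.norm ?_
  · exact (Continuous.aestronglyMeasurable (by fun_prop)).mul hg.ofReal.aestronglyMeasurable
  · refine Filter.Eventually.of_forall fun x => ?_
    rw [norm_mul, ← neg_mul, ← neg_mul, Complex.norm_exp]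
    simp
  · exact Filter.Eventually.of_forall fun x => by fun_prop

/-- The Gamma integral after the substitution `l ↦ 1 / l`. -/
lemma integral_rpow_mul_exp_neg_div {r c : ℝ} (hr : 0 < r) (hc : 0 < c) :
    ∫ l : ℝ in Set.Ioi 0, l ^ (-r - 1) * Real.exp (-(c * l⁻¹)) = c ^ (-r) * Real.Gamma r := by
  have h := integral_comp_rpow_Ioi (fun l : ℝ => l ^ (-r - 1) * Real.exp (-(c * l⁻¹)))
    (p := -1) (by norm_num)
  rw [← h, Real.rpow_neg hc.le, ← Real.inv_rpow hc.le, ← one_div,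
    ← Real.integral_rpow_mul_exp_neg_mul_Ioi hr hc]
  refine setIntegral_congr_fun measurableSet_Ioi fun x hx => ?_
  have hx : 0 < x := hx
  simp only [abs_neg, abs_one, one_mul, smul_eq_mul]
  rw [← Real.rpow_mul hx.le, ← mul_assoc, ← Real.rpow_add hx, Real.rpow_neg_one, inv_inv]
  congr 2
  ring

lemma cos_half_pos {s : ℝ} (hs0 : 0 ≤ s) (hs1 : s < 1) : 0 < Real.cos (s * Real.pi / 2) := by
  apply Real.cos_pos_of_mem_Ioo
  constructor <;> nlinarith [Real.pi_pos]

/-- The constant in the Fourier transform of the Riesz kernel, from the duplication formula at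
`s / 2` and the reflection formula at `(1 - s) / 2`. -/
lemma riesz_constant {s : ℝ} (hs0 : 0 < s) (hs1 : s < 1) :
    Real.sqrt Real.pi * Real.Gamma (s / 2) * 2 ^ s =
      2 * Real.Gamma s * Real.cos (s * Real.pi / 2) * Real.Gamma ((1 - s) / 2) := by
  have h1 := Real.Gamma_mul_Gamma_add_half (s / 2)
  have h2 := Real.Gamma_mul_Gamma_one_sub ((1 - s) / 2)
  have e1 : 1 - (1 - s) / 2 = s / 2 + 1 / 2 := by ring
  have e2 : Real.sin (Real.pi * ((1 - s) / 2)) = Real.cos (s * Real.pi / 2) := by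
    rw [← Real.sin_pi_div_two_sub]
    congr 1
    ring
  have hcos := cos_half_pos hs0.le hs1
  rw [e1, e2] at h2
  rw [show s / 2 + 1 / 2 = (s + 1) / 2 by ring] at h1 h2
  have hG : 0 < Real.Gamma ((s + 1) / 2) := Real.Gamma_pos_of_pos (by linarith)
  rw [show 2 * (s / 2) = s by ring, Real.rpow_sub (by norm_num), Real.rpow_one] at h1
  have hp := Real.mul_self_sqrt Real.pi_pos.le
  have h2s : (0 : ℝ) < 2 ^ s := by positivity
  rw [eq_div_iff hcos.ne'] at h2
  field_simp at h1
  apply mul_right_cancel₀ hG.ne'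
  linear_combination (Real.sqrt Real.pi) * h1 - 2 * Real.Gamma s * h2 + 2 * Real.Gamma s * hp

/-! ### The kernel of the fractional integral -/

lemma negSobolevNorm_half_sq (s : ℝ) (g : ℝ → ℝ) :
    negSobolevNorm (s / 2) g ^ 2 =
      ∫⁻ ω : ℝ, ENNReal.ofReal (|ω| ^ (-s)) * ENNReal.ofReal (‖fourierHat g ω‖ ^ 2) := by
  rw [negSobolevNorm, eLpNorm_eq_lintegral_rpow_enorm_toReal (by norm_num) (by norm_num),
    ← ENNReal.rpow_natCast, ← ENNReal.rpow_mul]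
  norm_num
  refine lintegral_congr fun ω => ?_
  rw [mul_pow, ← ofReal_norm, ← ENNReal.ofReal_pow (norm_nonneg _), Complex.norm_real,
    Real.norm_of_nonneg (by positivity), ← Real.rpow_mul_natCast (abs_nonneg _)]
  congr 3
  push_cast
  ring

/-- The kernel `z₊^{s-1}` of the left fractional integral, without the factor `1 / Γ(s)`. -/
noncomputable def leftKernel (s z : ℝ) : ℝ := if 0 < z then z ^ (s - 1) else 0

lemma measurable_leftKernel (s : ℝ) : Measurable (leftKernel s) :=
  Measurable.ite measurableSet_Ioi (by fun_prop) measurable_const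

lemma leftKernel_nonneg (s z : ℝ) : 0 ≤ leftKernel s z := by
  unfold leftKernel
  split_ifs <;> positivity

lemma leftKernel_add_leftKernel_neg {s : ℝ} (hs : s < 1) (z : ℝ) :
    leftKernel s z + leftKernel s (-z) = |z| ^ (s - 1) := by
  unfold leftKernel
  rcases lt_trichotomy z 0 with h | rfl | h
  · rw [if_neg (by linarith), if_pos (by linarith), abs_of_neg h, zero_add]
  -- at `0` both sides vanish, since `0 ^ (s - 1) = 0` by convention for `s ≠ 1`
  · simp [Real.zero_rpow (by linarith : s - 1 ≠ 0)]
  · rw [if_pos h, if_neg (by linarith), abs_of_pos h, add_zero]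

/-- The kernel is locally integrable, so it may be truncated to an integrable function. -/
lemma integrable_leftKernel_indicator {s : ℝ} (hs : 0 < s) (r : ℝ) :
    Integrable ((Set.Iic r).indicator (leftKernel s)) := by
  have h := (intervalIntegral.intervalIntegrable_rpow' (r := s - 1) (by linarith)
    (a := 0) (b := max r 0)).1
  have h2 := h.integrable_indicator measurableSet_Ioc
  refine h2.congr (Filter.Eventually.of_forall fun z => ?_)
  simp only [Set.indicator, leftKernel, Set.mem_Ioc, Set.mem_Iic, le_max_iff]
  split_ifs <;> first | rfl | (exfalso; grind)

lemma leftFracInt_eq_integral_leftKernel {a s x : ℝ} {g : ℝ → ℝ} (hs0 : 0 < s) (hs1 : s < 1)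
    (hx : a ≤ x) (hg : ∀ ξ < a, g ξ = 0) :
    leftFracInt a s g x = 1 / Real.Gamma s * ∫ ξ, leftKernel s (x - ξ) * g ξ := by
  rw [leftFracInt, if_neg hs0.ne', intervalIntegral.integral_of_le hx,
    ← integral_Icc_eq_integral_Ioc, ← integral_indicator measurableSet_Icc]
  congr 2
  ext ξ
  simp only [Set.indicator, leftKernel, Set.mem_Icc, sub_pos]
  rcases lt_trichotomy ξ x with h | rfl | h
  · by_cases h2 : a ≤ ξ
    · simp [h, h2, h.le]
    · simp [h, h2, hg ξ (not_le.1 h2)]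
  · simp [Real.zero_rpow (by linarith : s - 1 ≠ 0)]
  · simp [h.not_gt, h.not_ge]

lemma integrable_of_bounded_of_support {a b C : ℝ} {g : ℝ → ℝ} (hm : Measurable g)
    (hC : ∀ x, |g x| ≤ C) (hsupp : ∀ x ∉ Set.Icc a b, g x = 0) : Integrable g := by
  have : IntegrableOn g (Set.Icc a b) :=
    Measure.integrableOn_of_bounded (M := C) (by simp) hm.aestronglyMeasurable
      (Filter.Eventually.of_forall hC)
  rw [← integrable_indicator_iff measurableSet_Icc] at this
  refine this.congr (Filter.Eventually.of_forall fun x => ?_)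
  by_cases hx : x ∈ Set.Icc a b <;> simp [hx, hsupp]

/-- Integrability in both variables: on the support of `g x g ξ` the kernel only sees arguments at
most `b - a`, so the integrand is that of a convolution of integrable functions. -/
lemma integrable_leftKernel_mul {a b C s : ℝ} {g : ℝ → ℝ} (hs0 : 0 < s) (hm : Measurable g)
    (hC : ∀ x, |g x| ≤ C) (hsupp : ∀ x ∉ Set.Icc a b, g x = 0) :
    Integrable fun z : ℝ × ℝ => leftKernel s (z.1 - z.2) * (g z.1 * g z.2) := by
  have hg := integrable_of_bounded_of_support hm hC hsupp
  have h1 := hg.convolution_integrand (ContinuousLinearMap.mul ℝ ℝ)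
    (integrable_leftKernel_indicator hs0 (b - a))
  have h2 := h1.bdd_mul (f := fun z : ℝ × ℝ => g z.1) (c := C)
    (hm.comp measurable_fst).aestronglyMeasurable (Filter.Eventually.of_forall fun z => hC z.1)
  refine h2.congr (Filter.Eventually.of_forall fun z => ?_)
  simp only [ContinuousLinearMap.mul_apply', Set.indicator, Set.mem_Iic]
  by_cases hz1 : z.1 ∈ Set.Icc a b
  · by_cases hz2 : z.2 ∈ Set.Icc a b
    · rw [if_pos (by linarith [hz1.2, hz2.1])]
      ring
    · simp [hsupp _ hz2]
  · simp [hsupp _ hz1]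

lemma integrable_abs_rpow_mul {a b C s : ℝ} {g : ℝ → ℝ} (hs0 : 0 < s) (hs1 : s < 1)
    (hm : Measurable g) (hC : ∀ x, |g x| ≤ C) (hsupp : ∀ x ∉ Set.Icc a b, g x = 0) :
    Integrable fun z : ℝ × ℝ => |z.1 - z.2| ^ (s - 1) * (g z.1 * g z.2) := by
  have h := integrable_leftKernel_mul hs0 hm hC hsupp
  refine (h.add h.swap).congr (Filter.Eventually.of_forall fun z => ?_)
  simp only [Pi.add_apply, Function.comp, Prod.fst_swap, Prod.snd_swap]
  rw [← leftKernel_add_leftKernel_neg hs1, neg_sub]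
  ring

/-- The pairing `(ₐD_x^{-s} g, g)` is half the energy of the even Riesz kernel. -/
lemma integral_leftFracInt_mul_self {a b C s : ℝ} {g : ℝ → ℝ} (hs0 : 0 < s) (hs1 : s < 1)
    (hm : Measurable g) (hC : ∀ x, |g x| ≤ C) (hsupp : ∀ x ∉ Set.Icc a b, g x = 0) :
    ∫ x, leftFracInt a s g x * g x =
      1 / (2 * Real.Gamma s) * ∫ z : ℝ × ℝ, |z.1 - z.2| ^ (s - 1) * (g z.1 * g z.2) := by
  have h := integrable_leftKernel_mul hs0 hm hC hsupp
  have e1 : ∫ x, leftFracInt a s g x * g x =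
      1 / Real.Gamma s * ∫ z : ℝ × ℝ, leftKernel s (z.1 - z.2) * (g z.1 * g z.2) := by
    rw [Measure.volume_eq_prod, integral_prod _ h, ← integral_const_mul]
    congr 1
    ext x
    by_cases hx : x ∈ Set.Icc a b
    · rw [leftFracInt_eq_integral_leftKernel hs0 hs1 hx.1
        (fun ξ hξ => hsupp _ fun h => absurd h.1 (not_le.2 hξ)), mul_assoc, ← integral_mul_const]
      congr 2
      ext ξ
      ring
    · simp [hsupp _ hx]
  have e2 : ∫ z : ℝ × ℝ, |z.1 - z.2| ^ (s - 1) * (g z.1 * g z.2) =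
      2 * ∫ z : ℝ × ℝ, leftKernel s (z.1 - z.2) * (g z.1 * g z.2) := by
    have e3 := integral_prod_swap (μ := (volume : Measure ℝ)) (ν := (volume : Measure ℝ))
      (fun z : ℝ × ℝ => leftKernel s (z.1 - z.2) * (g z.1 * g z.2))
    have h' : Integrable (fun z : ℝ × ℝ => leftKernel s (z.swap.1 - z.swap.2) *
      (g z.swap.1 * g z.swap.2)) := h.swap
    rw [← Measure.volume_eq_prod] at e3
    rw [two_mul]
    nth_rewrite 2 [← e3]
    rw [← integral_add h h']
    congr 1
    ext z
    simp only [Prod.fst_swap, Prod.snd_swap]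
    rw [← leftKernel_add_leftKernel_neg hs1, neg_sub]
    ring
  have := (Real.Gamma_pos_of_pos hs0).ne'
  rw [e1, e2]
  field_simp

lemma ae_fst_ne_snd : ∀ᵐ z : ℝ × ℝ, z.1 ≠ z.2 := by
  rw [ae_iff, Measure.volume_eq_prod, Measure.measure_prod_null]
  · refine Filter.Eventually.of_forall fun x => ?_
    have : Prod.mk x ⁻¹' {z : ℝ × ℝ | ¬ z.1 ≠ z.2} = {x} := by
      ext y
      simp [eq_comm]
    simp only [this, Pi.zero_apply]
    simp
  · simpa using measurableSet_eq_fun measurable_fst measurable_snd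

lemma integral_rpow_mul_exp_neg_mul_sq {s z : ℝ} (hs1 : s < 1) (hz : z ≠ 0) :
    ∫ l in Set.Ioi (0 : ℝ), l ^ ((1 - s) / 2 - 1) * Real.exp (-l * z ^ 2) =
      |z| ^ (s - 1) * Real.Gamma ((1 - s) / 2) := by
  have h := Real.integral_rpow_mul_exp_neg_mul_Ioi (a := (1 - s) / 2) (r := z ^ 2)
    (by linarith) (by positivity)
  have e : (1 / z ^ 2) ^ ((1 - s) / 2) = |z| ^ (s - 1) := by
    rw [one_div, Real.inv_rpow (by positivity), ← sq_abs, ← Real.rpow_natCast,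
      ← Real.rpow_mul (abs_nonneg _), ← Real.rpow_neg (abs_nonneg _)]
    congr 1
    push_cast
    ring
  rw [← e, ← h]
  congr 1
  ext l
  congr 2
  ring

/-- Gaussian subordination of the Riesz kernel: `|z|^{s-1}` is a superposition of `e^{-l z²}`. -/
lemma integral_gaussian_superposition {a b C s : ℝ} {g : ℝ → ℝ} (hs0 : 0 < s) (hs1 : s < 1)
    (hm : Measurable g) (hC : ∀ x, |g x| ≤ C) (hsupp : ∀ x ∉ Set.Icc a b, g x = 0) :
    IntegrableOn (fun l : ℝ => l ^ ((1 - s) / 2 - 1) *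
      ∫ z : ℝ × ℝ, Real.exp (-l * (z.1 - z.2) ^ 2) * (g z.1 * g z.2)) (Set.Ioi 0) ∧
    ∫ l in Set.Ioi (0 : ℝ), l ^ ((1 - s) / 2 - 1) *
        ∫ z : ℝ × ℝ, Real.exp (-l * (z.1 - z.2) ^ 2) * (g z.1 * g z.2) =
      Real.Gamma ((1 - s) / 2) *
        ∫ z : ℝ × ℝ, |z.1 - z.2| ^ (s - 1) * (g z.1 * g z.2) := by
  have hI := integrable_abs_rpow_mul hs0 hs1 hm hC hsupp
  have hG : 0 < Real.Gamma ((1 - s) / 2) := Real.Gamma_pos_of_pos (by linarith)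
  set F : (ℝ × ℝ) × ℝ → ℝ := fun y => y.2 ^ ((1 - s) / 2 - 1) *
    Real.exp (-y.2 * (y.1.1 - y.1.2) ^ 2) * (g y.1.1 * g y.1.2) with hF
  have hFm : Measurable F := by
    have h1 : Measurable fun y : (ℝ × ℝ) × ℝ => g y.1.1 := hm.comp (by fun_prop)
    have h2 : Measurable fun y : (ℝ × ℝ) × ℝ => g y.1.2 := hm.comp (by fun_prop)
    fun_prop
  have hFi : Integrable F ((volume : Measure (ℝ × ℝ)).prod
      ((volume : Measure ℝ).restrict (Set.Ioi 0))) := by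
    rw [integrable_prod_iff hFm.aestronglyMeasurable]
    constructor
    · filter_upwards [ae_fst_ne_snd] with z hz
      have hz' : z.1 - z.2 ≠ 0 := sub_ne_zero.2 hz
      -- a Bochner integral that is not zero certifies integrability
      suffices h : Integrable (fun l : ℝ => l ^ ((1 - s) / 2 - 1) *
          Real.exp (-l * (z.1 - z.2) ^ 2)) (volume.restrict (Set.Ioi 0)) from
          h.mul_const (g z.1 * g z.2)
      apply not_imp_comm.1 integral_undef
      rw [integral_rpow_mul_exp_neg_mul_sq hs1 hz']
      positivity
    · refine (hI.norm.mul_const (Real.Gamma ((1 - s) / 2))).congr ?_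
      filter_upwards [ae_fst_ne_snd] with z hz
      have hz' : z.1 - z.2 ≠ 0 := sub_ne_zero.2 hz
      have : ∀ l ∈ Set.Ioi (0 : ℝ), ‖F (z, l)‖ = l ^ ((1 - s) / 2 - 1) *
          Real.exp (-l * (z.1 - z.2) ^ 2) * ‖g z.1 * g z.2‖ := by
        intro l hl
        have hl : 0 < l := hl
        simp only [hF]
        rw [norm_mul _ (g z.1 * g z.2), Real.norm_of_nonneg (by positivity)]
      rw [setIntegral_congr_fun measurableSet_Ioi this, integral_mul_const,
        integral_rpow_mul_exp_neg_mul_sq hs1 hz', norm_mul, Real.norm_of_nonneg (by positivity)]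
      ring
  have hpull : ∀ l : ℝ, ∫ z : ℝ × ℝ, F (z, l) = l ^ ((1 - s) / 2 - 1) *
        ∫ z : ℝ × ℝ, Real.exp (-l * (z.1 - z.2) ^ 2) * (g z.1 * g z.2) := by
    intro l
    rw [← integral_const_mul]
    congr 1
    ext z
    simp only [hF]
    ring
  constructor
  · refine hFi.integral_prod_right.congr (Filter.Eventually.of_forall hpull)
  · simp_rw [← hpull]
    rw [← integral_integral_swap (f := fun z l => F (z, l)) hFi, ← integral_const_mul]
    refine integral_congr_ae ?_
    filter_upwards [ae_fst_ne_snd] with z hz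
    simp only [hF]
    rw [integral_mul_const, integral_rpow_mul_exp_neg_mul_sq hs1 (sub_ne_zero.2 hz)]
    ring

/-! ### The energy of the fractional integral in one variable -/

lemma norm_fourierHat_le (g : ℝ → ℝ) (ω : ℝ) :
    ‖fourierHat g ω‖ ≤ 1 / Real.sqrt (2 * Real.pi) * ∫ x, ‖g x‖ := by
  rw [fourierHat, norm_mul, Complex.norm_real, Real.norm_of_nonneg (by positivity)]
  gcongr
  refine (norm_integral_le_integral_norm _).trans_eq ?_
  congr 1
  ext x
  rw [norm_mul, ← neg_mul, ← neg_mul, Complex.norm_exp]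
  simp

lemma integrable_gaussian_mul_normSq_fourierHat {g : ℝ → ℝ} (hg : Integrable g) {c : ℝ}
    (hc : 0 < c) : Integrable fun ω : ℝ => Real.exp (-c * ω ^ 2) * ‖fourierHat g ω‖ ^ 2 := by
  refine (integrable_exp_neg_mul_sq hc).mul_bdd
    (c := (1 / Real.sqrt (2 * Real.pi) * ∫ x, ‖g x‖) ^ 2)
    ((continuous_fourierHat hg).norm.pow 2).aestronglyMeasurable
    (Filter.Eventually.of_forall fun ω => ?_)
  rw [norm_pow, norm_norm]
  gcongr
  exact norm_fourierHat_le g ω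

/-- Gaussian subordination on the frequency side: superposing the weights `e^{-ω²/(4l)}` gives a
multiple of `|ω|^{-s}`. -/
lemma lintegral_gaussian_superposition {s : ℝ} (hs0 : 0 < s) {g : ℝ → ℝ} (hg : Integrable g) :
    ∫⁻ l in Set.Ioi (0 : ℝ), ENNReal.ofReal (l ^ (-(s / 2) - 1) *
        ∫ ω : ℝ, Real.exp (-(1 / (4 * l)) * ω ^ 2) * ‖fourierHat g ω‖ ^ 2) =
      ENNReal.ofReal (2 ^ s * Real.Gamma (s / 2)) *
        ∫⁻ ω : ℝ, ENNReal.ofReal (|ω| ^ (-s)) * ENNReal.ofReal (‖fourierHat g ω‖ ^ 2) := by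
  have hG : 0 < Real.Gamma (s / 2) := Real.Gamma_pos_of_pos (by linarith)
  have h1 : ∀ l ∈ Set.Ioi (0 : ℝ), ENNReal.ofReal (l ^ (-(s / 2) - 1) *
        ∫ ω : ℝ, Real.exp (-(1 / (4 * l)) * ω ^ 2) * ‖fourierHat g ω‖ ^ 2) =
      ∫⁻ ω : ℝ, ENNReal.ofReal (l ^ (-(s / 2) - 1) * Real.exp (-(1 / (4 * l)) * ω ^ 2)) *
        ENNReal.ofReal (‖fourierHat g ω‖ ^ 2) := by
    intro l hl
    have hl : 0 < l := hl
    rw [← integral_const_mul, ofReal_integral_eq_lintegral_ofReal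
      ((integrable_gaussian_mul_normSq_fourierHat hg (by positivity)).const_mul _)
      (Filter.Eventually.of_forall fun ω => by positivity)]
    refine lintegral_congr fun ω => ?_
    rw [← ENNReal.ofReal_mul (by positivity), mul_assoc]
  have hW : Measurable fun ω => ‖fourierHat g ω‖ ^ 2 :=
    ((continuous_fourierHat hg).norm.pow 2).measurable
  rw [setLIntegral_congr_fun measurableSet_Ioi h1, lintegral_lintegral_swap (by
    apply Measurable.aemeasurable
    have : Measurable fun y : ℝ × ℝ => ‖fourierHat g y.2‖ ^ 2 := hW.comp measurable_snd
    unfold Function.uncurry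
    fun_prop), ← lintegral_const_mul _ (by fun_prop)]
  refine lintegral_congr_ae ?_
  filter_upwards [compl_mem_ae_iff.2 (measure_singleton (0 : ℝ))] with ω hω
  have hω : ω ≠ 0 := hω
  have hint : ∫ l : ℝ in Set.Ioi 0, l ^ (-(s / 2) - 1) * Real.exp (-(1 / (4 * l)) * ω ^ 2) =
      2 ^ s * Real.Gamma (s / 2) * |ω| ^ (-s) := by
    have h := integral_rpow_mul_exp_neg_div (r := s / 2) (c := (|ω| / 2) ^ 2) (by positivity)
      (by positivity)
    rw [← Real.rpow_natCast, ← Real.rpow_mul (by positivity), Real.rpow_natCast,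
      show ((2 : ℕ) : ℝ) * -(s / 2) = -s by push_cast; ring,
      Real.div_rpow (by positivity) (by positivity), Real.rpow_neg zero_le_two s, div_inv_eq_mul]
      at h
    rw [show 2 ^ s * Real.Gamma (s / 2) * |ω| ^ (-s) = |ω| ^ (-s) * 2 ^ s * Real.Gamma (s / 2) by
      ring, ← h]
    refine setIntegral_congr_fun measurableSet_Ioi fun l hl => ?_
    have hl : 0 < l := hl
    congr 2
    rw [div_pow, sq_abs]
    field_simp
    norm_num
  rw [lintegral_mul_const _ (by fun_prop), ← mul_assoc, ← ENNReal.ofReal_mul (by positivity),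
    ← hint, ofReal_integral_eq_lintegral_ofReal]
  · apply not_imp_comm.1 integral_undef
    rw [hint]
    positivity
  · filter_upwards [ae_restrict_mem measurableSet_Ioi] with l hl
    have hl : 0 < l := hl
    positivity

/-- Integrating the Gaussian identity against `l^{-s/2-1} dl` and comparing the two
superpositions. -/
lemma negSobolevNorm_sq_of_pos {a b C s : ℝ} {g : ℝ → ℝ} (hs0 : 0 < s) (hs1 : s < 1)
    (hm : Measurable g) (hC : ∀ x, |g x| ≤ C) (hsupp : ∀ x ∉ Set.Icc a b, g x = 0) :
    negSobolevNorm (s / 2) g ^ 2 =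
      ENNReal.ofReal ((∫ x, leftFracInt a s g x * g x) / Real.cos (s * Real.pi / 2)) := by
  have hg := integrable_of_bounded_of_support hm hC hsupp
  have hG : 0 < Real.Gamma (s / 2) := Real.Gamma_pos_of_pos (by linarith)
  have hG1 : 0 < Real.Gamma s := Real.Gamma_pos_of_pos (by linarith)
  have hG2 : 0 < Real.Gamma ((1 - s) / 2) := Real.Gamma_pos_of_pos (by linarith)
  have hcos := cos_half_pos hs0.le hs1
  obtain ⟨h1, h2⟩ := integral_gaussian_superposition hs0 hs1 hm hC hsupp
  have h3 := lintegral_gaussian_superposition hs0 hg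
  have h4 : ∀ l ∈ Set.Ioi (0 : ℝ), l ^ (-(s / 2) - 1) *
        ∫ ω : ℝ, Real.exp (-(1 / (4 * l)) * ω ^ 2) * ‖fourierHat g ω‖ ^ 2 =
      1 / Real.sqrt Real.pi * (l ^ ((1 - s) / 2 - 1) *
      ∫ z : ℝ × ℝ, Real.exp (-l * (z.1 - z.2) ^ 2) * (g z.1 * g z.2)) := by
    intro l hl
    have hl : 0 < l := hl
    rw [gaussian_fourierHat hg hl, Real.sqrt_div hl.le, Real.sqrt_eq_rpow l,
      show (1 - s) / 2 - 1 = (-(s / 2) - 1) + 1 / 2 by ring, Real.rpow_add hl]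
    ring
  have h5 : ∫⁻ l in Set.Ioi (0 : ℝ), ENNReal.ofReal (l ^ (-(s / 2) - 1) *
        ∫ ω : ℝ, Real.exp (-(1 / (4 * l)) * ω ^ 2) * ‖fourierHat g ω‖ ^ 2) =
      ENNReal.ofReal (1 / Real.sqrt Real.pi * (Real.Gamma ((1 - s) / 2) *
        ∫ z : ℝ × ℝ, |z.1 - z.2| ^ (s - 1) * (g z.1 * g z.2))) := by
    rw [← h2, ← integral_const_mul, ← setIntegral_congr_fun measurableSet_Ioi h4,
      ofReal_integral_eq_lintegral_ofReal]
    · exact (h1.const_mul (1 / Real.sqrt Real.pi)).congr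
        (by filter_upwards [ae_restrict_mem measurableSet_Ioi] with l hl using (h4 l hl).symm)
    · filter_upwards [ae_restrict_mem measurableSet_Ioi] with l hl
      have hl : 0 < l := hl
      positivity
  rw [h5] at h3
  have hc : 0 < 2 ^ s * Real.Gamma (s / 2) := by positivity
  rw [negSobolevNorm_half_sq, integral_leftFracInt_mul_self hs0 hs1 hm hC hsupp]
  rw [← ENNReal.mul_right_inj (a := ENNReal.ofReal (2 ^ s * Real.Gamma (s / 2)))
    (by simpa using hc) ENNReal.ofReal_ne_top, ← h3, ← ENNReal.ofReal_mul hc.le]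
  congr 1
  have hk := riesz_constant hs0 hs1
  have hp : 0 < Real.sqrt Real.pi := Real.sqrt_pos.2 Real.pi_pos
  generalize (∫ z : ℝ × ℝ, |z.1 - z.2| ^ (s - 1) * (g z.1 * g z.2)) = I
  field_simp
  linear_combination (-I) * hk

/-- Plancherel's formula for bounded, compactly supported functions that are continuous almost
everywhere, by letting the width of a Gaussian tend to infinity. -/
lemma lintegral_normSq_fourierHat {a b C : ℝ} {g : ℝ → ℝ}
    (hm : Measurable g) (hC : ∀ x, |g x| ≤ C) (hsupp : ∀ x ∉ Set.Icc a b, g x = 0)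
    (hcont : ∀ᵐ x, ContinuousAt g x) :
    ∫⁻ ω : ℝ, ENNReal.ofReal (‖fourierHat g ω‖ ^ 2) = ENNReal.ofReal (∫ x, g x * g x) := by
  have hg := integrable_of_bounded_of_support hm hC hsupp
  have hC0 : 0 ≤ C := (abs_nonneg _).trans (hC 0)
  have hgauss : Integrable fun z : ℝ => Real.exp (-1 * z ^ 2) := integrable_exp_neg_mul_sq one_pos
  have hW : Measurable fun ω => ‖fourierHat g ω‖ ^ 2 :=
    ((continuous_fourierHat hg).norm.pow 2).measurable
  -- squares, so that the substitution `y = x + z / √l` has a rational factor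
  let l : ℕ → ℝ := fun n => ((n : ℝ) + 1) ^ 2
  have hl : ∀ n, 0 < l n := fun n => by positivity
  have hT1 : Filter.Tendsto (fun n => ∫⁻ ω : ℝ, ENNReal.ofReal
      (Real.exp (-(1 / (4 * l n)) * ω ^ 2) * ‖fourierHat g ω‖ ^ 2)) Filter.atTop
      (nhds (∫⁻ ω : ℝ, ENNReal.ofReal (‖fourierHat g ω‖ ^ 2))) := by
    refine lintegral_tendsto_of_tendsto_of_monotone (fun n => ?_) ?_ ?_
    · exact Measurable.aemeasurable (by fun_prop)
    · refine Filter.Eventually.of_forall fun ω n m hnm => ?_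
      have hlm : l n ≤ l m := by
        simp only [l]
        gcongr
      have h0 := hl n
      simp only [neg_mul]
      gcongr
    · refine Filter.Eventually.of_forall fun ω => ?_
      apply (ENNReal.continuous_ofReal.tendsto _).comp
      have : Filter.Tendsto (fun n => 1 / (4 * l n)) Filter.atTop (nhds 0) := by
        have h1 := (tendsto_one_div_add_atTop_nhds_zero_nat (𝕜 := ℝ)).pow 2
        have h2 := h1.const_mul (1 / 4)
        simp only [ne_eq, OfNat.ofNat_ne_zero, not_false_eq_true, zero_pow, mul_zero] at h2
        refine h2.congr fun n => ?_
        simp only [l]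
        field_simp
      have h3 : Filter.Tendsto (fun n => Real.exp (-(1 / (4 * l n)) * ω ^ 2) *
          ‖fourierHat g ω‖ ^ 2) Filter.atTop
          (nhds (Real.exp (-0 * ω ^ 2) * ‖fourierHat g ω‖ ^ 2)) :=
        ((Real.continuous_exp.tendsto _).comp (this.neg.mul_const _)).mul_const _
      simpa using h3
  have hval : ∀ n, ∫ ω : ℝ, Real.exp (-(1 / (4 * l n)) * ω ^ 2) * ‖fourierHat g ω‖ ^ 2 =
      ∫ x, g x * (1 / Real.sqrt Real.pi *
        ∫ z, Real.exp (-1 * z ^ 2) * g (x + z * (1 / ((n : ℝ) + 1)))) := by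
    intro n
    have hn : (0 : ℝ) < n + 1 := by positivity
    rw [gaussian_fourierHat hg (hl n), Measure.volume_eq_prod, integral_prod,
      ← integral_const_mul]
    · congr 1
      ext x
      have e1 : ∫ y, Real.exp (-l n * (x - y) ^ 2) * (g x * g y) =
          ∫ y, Real.exp (-l n * y ^ 2) * (g x * g (x + y)) := by
        rw [← integral_add_left_eq_self _ x]
        congr 1
        ext y
        congr 3
        ring
      have e2 := Measure.integral_comp_mul_right
        (fun y => Real.exp (-l n * y ^ 2) * (g x * g (x + y))) (1 / ((n : ℝ) + 1))
      have e3 : ∀ z : ℝ, -l n * (z * (1 / ((n : ℝ) + 1))) ^ 2 = -1 * z ^ 2 := by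
        intro z
        simp only [l]
        field_simp
      simp only [e3] at e2
      have e4 : |(1 / ((n : ℝ) + 1))⁻¹| = n + 1 := by
        rw [one_div, inv_inv, abs_of_pos hn]
      have e5 : Real.sqrt (l n / Real.pi) = (n + 1) / Real.sqrt Real.pi := by
        rw [Real.sqrt_div (hl n).le, Real.sqrt_sq hn.le]
      rw [e4, smul_eq_mul] at e2
      rw [e1, e5, div_mul_eq_mul_div, ← e2, ← integral_const_mul, ← integral_const_mul,
        ← integral_div]
      congr 1
      ext z
      ring
    · have h0 := hl n
      refine (hg.mul_prod hg).bdd_mul (c := 1) (by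
        apply Continuous.aestronglyMeasurable
        fun_prop) (Filter.Eventually.of_forall fun z => ?_)
      rw [Real.norm_of_nonneg (Real.exp_pos _).le, Real.exp_le_one_iff]
      nlinarith [sq_nonneg (z.1 - z.2)]
  have hT2 : Filter.Tendsto (fun n : ℕ => ∫ x, g x * (1 / Real.sqrt Real.pi *
        ∫ z, Real.exp (-1 * z ^ 2) * g (x + z * (1 / ((n : ℝ) + 1))))) Filter.atTop
        (nhds (∫ x, g x * g x)) := by
    have hbd : ∀ (n : ℕ) (x z : ℝ),
        ‖Real.exp (-1 * z ^ 2) * g (x + z * (1 / ((n : ℝ) + 1)))‖ ≤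
          Real.exp (-1 * z ^ 2) * C := by
      intro n x z
      rw [norm_mul, Real.norm_of_nonneg (Real.exp_pos _).le]
      gcongr
      exact hC _
    refine tendsto_integral_of_dominated_convergence
      (fun x => |g x| * (1 / Real.sqrt Real.pi * ∫ z, Real.exp (-1 * z ^ 2) * C))
      (fun n => ?_) (hg.abs.mul_const _) (fun n => ?_) ?_
    · refine hm.aestronglyMeasurable.mul (StronglyMeasurable.aestronglyMeasurable ?_)
      have : Measurable fun y : ℝ × ℝ =>
          Real.exp (-1 * y.2 ^ 2) * g (y.1 + y.2 * (1 / ((n : ℝ) + 1))) := by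
        have : Measurable fun y : ℝ × ℝ => g (y.1 + y.2 * (1 / ((n : ℝ) + 1))) :=
          hm.comp (by fun_prop)
        fun_prop
      exact this.stronglyMeasurable.integral_prod_right.const_mul _
    · refine Filter.Eventually.of_forall fun x => ?_
      rw [norm_mul, norm_mul, Real.norm_eq_abs, Real.norm_of_nonneg (by positivity)]
      gcongr
      exact norm_integral_le_of_norm_le (hgauss.mul_const C)
        (Filter.Eventually.of_forall (hbd n x))
    · filter_upwards [hcont] with x hx
      apply Filter.Tendsto.const_mul
      have h1 : Filter.Tendsto (fun n : ℕ => ∫ z, Real.exp (-1 * z ^ 2) *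
          g (x + z * (1 / ((n : ℝ) + 1)))) Filter.atTop
          (nhds (∫ z, Real.exp (-1 * z ^ 2) * g x)) := by
        refine tendsto_integral_of_dominated_convergence (fun z => Real.exp (-1 * z ^ 2) * C)
          (fun n => ?_) (hgauss.mul_const C)
          (fun n => Filter.Eventually.of_forall (hbd n x)) ?_
        · have : Measurable fun z : ℝ => g (x + z * (1 / ((n : ℝ) + 1))) :=
            hm.comp (by fun_prop)
          exact Measurable.aestronglyMeasurable (by fun_prop)
        · refine Filter.Eventually.of_forall fun z => ?_
          apply Filter.Tendsto.const_mul
          have h2 : Filter.Tendsto (fun n : ℕ => x + z * (1 / ((n : ℝ) + 1))) Filter.atTop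
              (nhds x) := by
            simpa using ((tendsto_one_div_add_atTop_nhds_zero_nat (𝕜 := ℝ)).const_mul
              z).const_add x
          exact hx.tendsto.comp h2
      have h2 := h1.const_mul (1 / Real.sqrt Real.pi)
      have h3 : 1 / Real.sqrt Real.pi * ∫ z, Real.exp (-1 * z ^ 2) * g x = g x := by
        have hp : 0 < Real.sqrt Real.pi := Real.sqrt_pos.2 Real.pi_pos
        rw [integral_mul_const, integral_gaussian, div_one]
        field_simp
      rwa [h3] at h2
  have hT3 := (ENNReal.continuous_ofReal.tendsto _).comp hT2
  refine tendsto_nhds_unique hT1 (hT3.congr fun n => ?_)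
  have h0 := hl n
  rw [Function.comp, ← hval, ofReal_integral_eq_lintegral_ofReal
    (integrable_gaussian_mul_normSq_fourierHat hg (by positivity))
    (Filter.Eventually.of_forall fun ω => by positivity)]

/-- For `0 ≤ s < 1` the pairing `(ₐD_x^{-s} g, g)` is `cos (sπ/2) ‖g‖²_{H^{-s/2}}`. -/
theorem negSobolevNorm_sq {a b C s : ℝ} {g : ℝ → ℝ} (hs0 : 0 ≤ s) (hs1 : s < 1)
    (hm : Measurable g) (hC : ∀ x, |g x| ≤ C) (hsupp : ∀ x ∉ Set.Icc a b, g x = 0)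
    (hcont : ∀ᵐ x, ContinuousAt g x) :
    negSobolevNorm (s / 2) g ^ 2 =
      ENNReal.ofReal ((∫ x, leftFracInt a s g x * g x) / Real.cos (s * Real.pi / 2)) := by
  rcases hs0.eq_or_lt with rfl | hs
  · have : ∀ x, leftFracInt a 0 g x = g x := fun x => if_pos rfl
    rw [negSobolevNorm_half_sq]
    simp only [neg_zero, Real.rpow_zero, ENNReal.ofReal_one, one_mul, this, zero_mul, zero_div,
      Real.cos_zero, div_one]
    exact lintegral_normSq_fourierHat hm hC hsupp hcont
  · exact negSobolevNorm_sq_of_pos hs hs1 hm hC hsupp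

/-! ### Triangles -/

/-- Twice the signed area of the triangle with vertices `A`, `B`, `P`. -/
def signedArea (A B P : ℝ × ℝ) : ℝ := (B.1 - A.1) * (P.2 - A.2) - (B.2 - A.2) * (P.1 - A.1)

/-- The affine map that carries `(0,0)`, `(1,0)`, `(0,1)` to `A`, `B`, `P`. -/
def simplexMap (A B P : ℝ × ℝ) (z : ℝ × ℝ) : ℝ × ℝ :=
  (A.1 + z.1 * (B.1 - A.1) + z.2 * (P.1 - A.1), A.2 + z.1 * (B.2 - A.2) + z.2 * (P.2 - A.2))

/-- The closed reference triangle. -/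
def refSimplex : Set (ℝ × ℝ) := {z | 0 ≤ z.1 ∧ 0 ≤ z.2 ∧ z.1 + z.2 ≤ 1}

lemma isClosed_refSimplex : IsClosed refSimplex :=
  (isClosed_le continuous_const continuous_fst).inter
    ((isClosed_le continuous_const continuous_snd).inter
      (isClosed_le (continuous_fst.add continuous_snd) continuous_const))

lemma isCompact_refSimplex : IsCompact refSimplex := by
  refine (isCompact_Icc (a := ((0 : ℝ), (0 : ℝ))) (b := ((1 : ℝ), (1 : ℝ)))).of_isClosed_subset
    isClosed_refSimplex fun z hz => ?_
  obtain ⟨h1, h2, h3⟩ := hz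
  exact ⟨⟨h1, h2⟩, ⟨by simp only; linarith, by simp only; linarith⟩⟩

/-- If the signed area vanished, its cofactors would be the weights of an affine dependence. -/
lemma signedArea_ne_zero {p : Fin 3 → ℝ × ℝ} (h : AffineIndependent ℝ p) :
    signedArea (p 0) (p 1) (p 2) ≠ 0 := by
  intro h0
  rw [affineIndependent_iff] at h
  have key : ∀ w : Fin 3 → ℝ, w 0 + w 1 + w 2 = 0 →
      w 0 * (p 0).1 + w 1 * (p 1).1 + w 2 * (p 2).1 = 0 →
      w 0 * (p 0).2 + w 1 * (p 1).2 + w 2 * (p 2).2 = 0 → w 1 = 0 ∧ w 2 = 0 := by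
    intro w h1 h2 h3
    have := h Finset.univ w (by simpa [Fin.sum_univ_three] using h1)
      (by ext <;> simp [Fin.sum_univ_three, h2, h3])
    exact ⟨this 1 (Finset.mem_univ _), this 2 (Finset.mem_univ _)⟩
  unfold signedArea at h0
  have k1 := key ![(p 1).1 - (p 2).1, (p 2).1 - (p 0).1, (p 0).1 - (p 1).1] (by simp) (by simp; ring)
    (by simp; linarith)
  have k2 := key ![(p 1).2 - (p 2).2, (p 2).2 - (p 0).2, (p 0).2 - (p 1).2] (by simp)
    (by simp; linarith) (by simp; ring)
  simp only [Matrix.cons_val_one, Matrix.cons_val_zero, Matrix.cons_val] at k1 k2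
  have k3 := key ![-1, 1, 0] (by simp) (by simp; linarith) (by simp; linarith)
  simp at k3

lemma convexHull_eq_image_simplexMap (A B P : ℝ × ℝ) :
    convexHull ℝ {A, B, P} = simplexMap A B P '' refSimplex := by
  apply Set.Subset.antisymm
  · apply convexHull_min
    · rintro x (rfl | rfl | rfl)
      · exact ⟨(0, 0), by simp [refSimplex], by simp [simplexMap]⟩
      · exact ⟨(1, 0), by simp [refSimplex], by simp [simplexMap]⟩
      · exact ⟨(0, 1), by simp [refSimplex], by simp [simplexMap]⟩
    · rintro _ ⟨z, ⟨h1, h2, h3⟩, rfl⟩ _ ⟨w, ⟨h4, h5, h6⟩, rfl⟩ s t hs ht hst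
      refine ⟨s • z + t • w, ⟨?_, ?_, ?_⟩, ?_⟩
      · simp only [Prod.fst_add, Prod.smul_fst, smul_eq_mul]
        positivity
      · simp only [Prod.snd_add, Prod.smul_snd, smul_eq_mul]
        positivity
      · simp only [Prod.fst_add, Prod.smul_fst, smul_eq_mul, Prod.snd_add, Prod.smul_snd]
        nlinarith
      · have : s = 1 - t := by linarith
        subst this
        ext <;> simp [simplexMap] <;> ring
  · rintro _ ⟨z, ⟨h1, h2, h3⟩, rfl⟩
    refine mem_convexHull_of_exists_fintype ![1 - z.1 - z.2, z.1, z.2] ![A, B, P] ?_ ?_ ?_ ?_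
    · intro i
      fin_cases i <;> simp <;> linarith
    · simp [Fin.sum_univ_three]
      ring
    · intro i
      fin_cases i <;> simp
    · ext <;> simp [Fin.sum_univ_three, simplexMap] <;> ring

/-- A point with positive barycentric coordinates is interior to the triangle. -/
lemma mem_interior_triangle {A B P X : ℝ × ℝ} (h0 : signedArea A B P ≠ 0)
    (h1 : 0 < signedArea A X P / signedArea A B P) (h2 : 0 < signedArea A B X / signedArea A B P)
    (h3 : 0 < signedArea X B P / signedArea A B P) : X ∈ interior (convexHull ℝ {A, B, P}) := by
  rw [mem_interior]
  refine ⟨{Y | 0 < signedArea A Y P / signedArea A B P} ∩ ({Y | 0 < signedArea A B Y /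
    signedArea A B P} ∩ {Y | 0 < signedArea Y B P / signedArea A B P}), ?_, ?_, h1, h2, h3⟩
  · rintro Y ⟨k1, k2, k3⟩
    rw [convexHull_eq_image_simplexMap]
    have hsum : signedArea A Y P / signedArea A B P + signedArea A B Y / signedArea A B P =
        1 - signedArea Y B P / signedArea A B P := by
      field_simp
      unfold signedArea
      ring
    refine ⟨(signedArea A Y P / signedArea A B P, signedArea A B Y / signedArea A B P),
      ⟨le_of_lt k1, le_of_lt k2, ?_⟩, ?_⟩
    · have : 0 < signedArea Y B P / signedArea A B P := k3
      simp only
      linarith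
    · ext <;> simp only [simplexMap] <;> field_simp <;> unfold signedArea <;> ring
  · unfold signedArea
    exact (isOpen_lt continuous_const (by fun_prop)).inter
      ((isOpen_lt continuous_const (by fun_prop)).inter
        (isOpen_lt continuous_const (by fun_prop)))

/-- Two triangles on the same side of a common edge overlap. -/
lemma not_disjoint_interior_of_same_side {A B P P' : ℝ × ℝ}
    (h : 0 < signedArea A B P * signedArea A B P') :
    ¬ Disjoint (interior (convexHull ℝ {A, B, P})) (interior (convexHull ℝ {A, B, P'})) := by
  have h0 : signedArea A B P ≠ 0 := fun h' => by simp [h'] at h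
  have h0' : signedArea A B P' ≠ 0 := fun h' => by simp [h'] at h
  -- points close to the midpoint of the edge, displaced towards `P'`
  let X : ℝ → ℝ × ℝ := fun ε => ((1 - ε) * ((A.1 + B.1) / 2) + ε * P'.1,
    (1 - ε) * ((A.2 + B.2) / 2) + ε * P'.2)
  have side : ∀ ε, signedArea A B (X ε) = ε * signedArea A B P' := by
    intro ε
    simp only [signedArea, X]
    ring
  have hev : ∀ φ : ℝ → ℝ, Continuous φ → φ 0 = 1 / 2 →
      ∀ᶠ ε in nhdsWithin 0 (Set.Ioi 0), 0 < φ ε := by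
    intro φ hφ h1
    refine nhdsWithin_le_nhds (hφ.continuousAt.eventually (lt_mem_nhds ?_))
    rw [h1]
    norm_num
  have e1 := hev (fun ε => signedArea A (X ε) P / signedArea A B P)
    (by simp only [signedArea, X]; fun_prop)
    (by field_simp; simp only [signedArea, X]; ring)
  have e2 := hev (fun ε => signedArea (X ε) B P / signedArea A B P)
    (by simp only [signedArea, X]; fun_prop)
    (by field_simp; simp only [signedArea, X]; ring)
  have e3 := hev (fun ε => signedArea A (X ε) P' / signedArea A B P')
    (by simp only [signedArea, X]; fun_prop)
    (by field_simp; simp only [signedArea, X]; ring)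
  have e4 := hev (fun ε => signedArea (X ε) B P' / signedArea A B P')
    (by simp only [signedArea, X]; fun_prop)
    (by field_simp; simp only [signedArea, X]; ring)
  obtain ⟨ε, ⟨⟨⟨h1, h2⟩, h3⟩, h4⟩, hε⟩ :=
    (((e1.and e2).and e3).and e4).and self_mem_nhdsWithin |>.exists
  have hε : 0 < ε := hε
  rw [Set.not_disjoint_iff]
  refine ⟨X ε, mem_interior_triangle h0 h1 ?_ h2, mem_interior_triangle h0' h3 ?_ h4⟩
  · rw [side]
    have : signedArea A B P' / signedArea A B P =
        signedArea A B P * signedArea A B P' / signedArea A B P ^ 2 := by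
      field_simp
    rw [mul_div_assoc, this]
    positivity
  · rw [side]
    field_simp
    exact hε

lemma hasFDerivAt_simplexMap (A B P z : ℝ × ℝ) :
    HasFDerivAt (simplexMap A B P)
      (((B.1 - A.1) • ContinuousLinearMap.fst ℝ ℝ ℝ +
          (P.1 - A.1) • ContinuousLinearMap.snd ℝ ℝ ℝ).prod
        ((B.2 - A.2) • ContinuousLinearMap.fst ℝ ℝ ℝ +
          (P.2 - A.2) • ContinuousLinearMap.snd ℝ ℝ ℝ)) z := by
  unfold simplexMap
  refine HasFDerivAt.prodMk ?_ ?_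
  · exact ((hasFDerivAt_fst.mul_const _).const_add _).add (hasFDerivAt_snd.mul_const _)
  · exact ((hasFDerivAt_fst.mul_const _).const_add _).add (hasFDerivAt_snd.mul_const _)

/-- Change of variables to the reference triangle. -/
lemma setIntegral_triangle {A B P : ℝ × ℝ} (h0 : signedArea A B P ≠ 0) (g : ℝ × ℝ → ℝ) :
    ∫ x in convexHull ℝ {A, B, P}, g x =
      |signedArea A B P| * ∫ z in refSimplex, g (simplexMap A B P z) := by
  rw [convexHull_eq_image_simplexMap, integral_image_eq_integral_abs_det_fderiv_smul volume
    isClosed_refSimplex.measurableSet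
    (fun z _ => (hasFDerivAt_simplexMap A B P z).hasFDerivWithinAt), ← integral_const_mul]
  · congr 1
    ext z
    rw [smul_eq_mul]
    congr 2
    rw [ContinuousLinearMap.det, ← LinearMap.det_toMatrix (Module.Basis.finTwoProd ℝ),
      Matrix.det_fin_two]
    simp [LinearMap.toMatrix_apply, signedArea]
    ring
  · rintro ⟨s, t⟩ - ⟨s', t'⟩ - h
    simp only [simplexMap, Prod.mk.injEq] at h
    obtain ⟨h1, h2⟩ := h
    have k1 : (s - s') * signedArea A B P = 0 := by
      unfold signedArea
      linear_combination (P.2 - A.2) * h1 - (P.1 - A.1) * h2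
    have k2 : (t - t') * signedArea A B P = 0 := by
      unfold signedArea
      linear_combination (B.1 - A.1) * h2 - (B.2 - A.2) * h1
    have k1' := (mul_eq_zero.1 k1).resolve_right h0
    have k2' := (mul_eq_zero.1 k2).resolve_right h0
    ext <;> simp only <;> linarith

lemma integrable_indicator_refSimplex {h : ℝ × ℝ → ℝ} (hc : Continuous h) :
    Integrable (refSimplex.indicator h) :=
  (hc.continuousOn.integrableOn_compact isCompact_refSimplex).integrable_indicator
    isClosed_refSimplex.measurableSet

/-- The integral over a slice of the reference triangle. -/
lemma integral_slice (φ : ℝ → ℝ → ℝ) (s : ℝ) :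
    ∫ t, (if 0 ≤ s ∧ 0 ≤ t ∧ s + t ≤ 1 then φ s t else 0) =
      (Set.Icc (0 : ℝ) 1).indicator (fun s => ∫ t in (0 : ℝ)..(1 - s), φ s t) s := by
  by_cases hs : s ∈ Set.Icc (0 : ℝ) 1
  · rw [Set.indicator_of_mem hs, intervalIntegral.integral_of_le (by linarith [hs.2]),
      ← integral_Icc_eq_integral_Ioc, ← integral_indicator measurableSet_Icc]
    congr 1
    ext t
    simp only [Set.indicator, Set.mem_Icc]
    have h1 := hs.1
    have : (0 ≤ s ∧ 0 ≤ t ∧ s + t ≤ 1) ↔ (0 ≤ t ∧ t ≤ 1 - s) := by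
      constructor
      · rintro ⟨_, h2, h3⟩
        exact ⟨h2, by linarith⟩
      · rintro ⟨h2, h3⟩
        exact ⟨h1, h2, by linarith⟩
    simp only [this]
  · have : ∀ t, (if 0 ≤ s ∧ 0 ≤ t ∧ s + t ≤ 1 then φ s t else 0) = 0 := fun t =>
      if_neg fun ⟨h1, h2, h3⟩ => hs ⟨h1, by linarith⟩
    simp only [this, Set.indicator_of_notMem hs, integral_zero]

lemma setIntegral_refSimplex {h : ℝ × ℝ → ℝ} (hc : Continuous h) :
    ∫ z in refSimplex, h z = ∫ s in (0 : ℝ)..1, ∫ t in (0 : ℝ)..(1 - s), h (s, t) := by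
  rw [← integral_indicator isClosed_refSimplex.measurableSet, Measure.volume_eq_prod,
    integral_prod _ (integrable_indicator_refSimplex hc),
    intervalIntegral.integral_of_le zero_le_one, ← integral_Icc_eq_integral_Ioc,
    ← integral_indicator measurableSet_Icc]
  congr 1
  ext s
  rw [← integral_slice fun s t => h (s, t)]
  congr 1
  ext t
  simp only [Set.indicator, refSimplex, Set.mem_ofPred_eq]
  congr 1

lemma setIntegral_refSimplex_symm {h : ℝ × ℝ → ℝ} (hc : Continuous h) :
    ∫ z in refSimplex, h z = ∫ t in (0 : ℝ)..1, ∫ s in (0 : ℝ)..(1 - t), h (s, t) := by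
  rw [← integral_indicator isClosed_refSimplex.measurableSet, Measure.volume_eq_prod,
    integral_prod_symm _ (integrable_indicator_refSimplex hc),
    intervalIntegral.integral_of_le zero_le_one, ← integral_Icc_eq_integral_Ioc,
    ← integral_indicator measurableSet_Icc]
  congr 1
  ext t
  rw [← integral_slice fun t s => h (s, t)]
  congr 1
  ext s
  simp only [Set.indicator, refSimplex, Set.mem_ofPred_eq]
  congr 1
  grind

/-! ### Polynomials in two variables -/

open MvPolynomial in
/-- The chain rule for a polynomial along a curve. -/
lemma hasDerivAt_eval {x y : ℝ → ℝ} {x' y' r : ℝ} (hx : HasDerivAt x x' r)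
    (hy : HasDerivAt y y' r) (f : MvPolynomial (Fin 2) ℝ) :
    HasDerivAt (fun s => eval ![x s, y s] f)
      (eval ![x r, y r] (pderiv 0 f) * x' + eval ![x r, y r] (pderiv 1 f) * y') r := by
  induction f using MvPolynomial.induction_on with
  | C a => simpa using hasDerivAt_const r a
  | add p q hp hq =>
    simp only [map_add]
    convert! hp.add hq using 1
    ring
  | mul_X p n hp =>
    simp only [map_mul, eval_X, pderiv_mul, map_add]
    fin_cases n
    · convert! hp.mul hx using 1
      simp [pderiv_X]
      ring
    · convert! hp.mul hy using 1
      simp [pderiv_X]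
      ring

lemma continuous_evalPair (f : MvPolynomial (Fin 2) ℝ) :
    Continuous fun x : ℝ × ℝ => MvPolynomial.eval ![x.1, x.2] f :=
  (MvPolynomial.continuous_eval f).comp (by fun_prop)

/-! ### The divergence theorem on a triangle -/

/-- The integral of `f` along the segment from `A` to `B`, parametrized over `[0,1]`. -/
noncomputable def segInt (f : ℝ × ℝ → ℝ) (A B : ℝ × ℝ) : ℝ :=
  ∫ r in (0 : ℝ)..1, f (A + r • (B - A))

lemma segInt_comm (f : ℝ × ℝ → ℝ) (A B : ℝ × ℝ) : segInt f A B = segInt f B A := by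
  have := intervalIntegral.integral_comp_sub_left (a := 0) (b := 1)
    (fun r : ℝ => f (B + r • (A - B))) 1
  rw [sub_self, sub_zero] at this
  rw [segInt, segInt, ← this]
  congr 1
  ext r
  congr 1
  ext <;> simp <;> ring

/-- The integral over the reference triangle of the derivative in the first variable of `f` composed
with `simplexMap A B P`. -/
lemma setIntegral_deriv_fst (f : MvPolynomial (Fin 2) ℝ) (A B P : ℝ × ℝ) :
    ∫ z in refSimplex,
      ((B.1 - A.1) * MvPolynomial.eval ![(simplexMap A B P z).1, (simplexMap A B P z).2]
          (MvPolynomial.pderiv 0 f) +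
        (B.2 - A.2) * MvPolynomial.eval ![(simplexMap A B P z).1, (simplexMap A B P z).2]
          (MvPolynomial.pderiv 1 f)) =
      segInt (fun x => MvPolynomial.eval ![x.1, x.2] f) B P -
        segInt (fun x => MvPolynomial.eval ![x.1, x.2] f) P A := by
  have hS : Continuous (simplexMap A B P) := by
    unfold simplexMap
    fun_prop
  have hc : ∀ p : MvPolynomial (Fin 2) ℝ, Continuous fun z : ℝ × ℝ =>
      MvPolynomial.eval ![(simplexMap A B P z).1, (simplexMap A B P z).2] p :=
    fun p => (continuous_evalPair p).comp hS
  have hc0 := hc (MvPolynomial.pderiv 0 f)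
  have hc1 := hc (MvPolynomial.pderiv 1 f)
  have hcf := hc f
  rw [setIntegral_refSimplex_symm (by fun_prop), segInt_comm _ P A, segInt, segInt,
    ← intervalIntegral.integral_sub]
  · congr 1
    ext t
    rw [intervalIntegral.integral_eq_sub_of_hasDerivAt (f := fun s =>
      MvPolynomial.eval ![(simplexMap A B P (s, t)).1, (simplexMap A B P (s, t)).2] f)]
    · congr 4 <;> simp [simplexMap] <;> ring_nf
    · intro s _
      have h1 : HasDerivAt (fun s => (simplexMap A B P (s, t)).1) (B.1 - A.1) s := by
        simpa [simplexMap] using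
          (((hasDerivAt_id s).mul_const (B.1 - A.1)).const_add A.1).add_const (t * (P.1 - A.1))
      have h2 : HasDerivAt (fun s => (simplexMap A B P (s, t)).2) (B.2 - A.2) s := by
        simpa [simplexMap] using
          (((hasDerivAt_id s).mul_const (B.2 - A.2)).const_add A.2).add_const (t * (P.2 - A.2))
      convert! hasDerivAt_eval h1 h2 f using 1
      ring
    · apply Continuous.intervalIntegrable
      have : Continuous fun s : ℝ => (s, t) := by fun_prop
      exact ((continuous_const.mul (hc0.comp this)).add (continuous_const.mul (hc1.comp this)))
  · apply Continuous.intervalIntegrable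
    exact (continuous_evalPair f).comp (by fun_prop)
  · apply Continuous.intervalIntegrable
    exact (continuous_evalPair f).comp (by fun_prop)

lemma setIntegral_refSimplex_swap {h : ℝ × ℝ → ℝ} (hc : Continuous h) :
    ∫ z in refSimplex, h z.swap = ∫ z in refSimplex, h z := by
  rw [setIntegral_refSimplex hc, 
    setIntegral_refSimplex_symm (h := fun z => h z.swap) (hc.comp continuous_swap)]
  rfl

/-- The same for the derivative in the second variable, by interchanging `B` and `P`. -/
lemma setIntegral_deriv_snd (f : MvPolynomial (Fin 2) ℝ) (A B P : ℝ × ℝ) :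
    ∫ z in refSimplex,
      ((P.1 - A.1) * MvPolynomial.eval ![(simplexMap A B P z).1, (simplexMap A B P z).2]
          (MvPolynomial.pderiv 0 f) +
        (P.2 - A.2) * MvPolynomial.eval ![(simplexMap A B P z).1, (simplexMap A B P z).2]
          (MvPolynomial.pderiv 1 f)) =
      segInt (fun x => MvPolynomial.eval ![x.1, x.2] f) B P -
        segInt (fun x => MvPolynomial.eval ![x.1, x.2] f) A B := by
  have hS : Continuous (simplexMap A P B) := by
    unfold simplexMap
    fun_prop
  have hc : ∀ p : MvPolynomial (Fin 2) ℝ, Continuous fun z : ℝ × ℝ =>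
      MvPolynomial.eval ![(simplexMap A P B z).1, (simplexMap A P B z).2] p :=
    fun p => (continuous_evalPair p).comp hS
  have hc0 := hc (MvPolynomial.pderiv 0 f)
  have hc1 := hc (MvPolynomial.pderiv 1 f)
  have hswap : ∀ z, simplexMap A B P z = simplexMap A P B z.swap := by
    intro z
    ext <;> simp [simplexMap] <;> ring
  simp only [hswap]
  refine (setIntegral_refSimplex_swap (((continuous_const (y := P.1 - A.1)).mul hc0).add
    ((continuous_const (y := P.2 - A.2)).mul hc1))).trans ?_
  rw [segInt_comm _ A B, segInt_comm _ B P]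
  exact setIntegral_deriv_fst f A P B

/-- The divergence theorem on a triangle for a polynomial vector field `(f, g)`.  On the right,
`sign · (y_B - y_A, x_A - x_B)` is the outward normal of the side `AB` times its length. -/
theorem divergence_triangle (f g : MvPolynomial (Fin 2) ℝ) {A B P : ℝ × ℝ}
    (h0 : signedArea A B P ≠ 0) :
    ∫ x in convexHull ℝ {A, B, P}, (MvPolynomial.eval ![x.1, x.2] (MvPolynomial.pderiv 0 f) +
        MvPolynomial.eval ![x.1, x.2] (MvPolynomial.pderiv 1 g)) =
      Real.sign (signedArea A B P) *
        (((P.2 - B.2) * segInt (fun x => MvPolynomial.eval ![x.1, x.2] f) B P +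
            (A.2 - P.2) * segInt (fun x => MvPolynomial.eval ![x.1, x.2] f) P A +
            (B.2 - A.2) * segInt (fun x => MvPolynomial.eval ![x.1, x.2] f) A B) -
          ((P.1 - B.1) * segInt (fun x => MvPolynomial.eval ![x.1, x.2] g) B P +
            (A.1 - P.1) * segInt (fun x => MvPolynomial.eval ![x.1, x.2] g) P A +
            (B.1 - A.1) * segInt (fun x => MvPolynomial.eval ![x.1, x.2] g) A B)) := by
  have hS : Continuous (simplexMap A B P) := by
    unfold simplexMap
    fun_prop
  have hc : ∀ p : MvPolynomial (Fin 2) ℝ, IntegrableOn (fun z : ℝ × ℝ =>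
      MvPolynomial.eval ![(simplexMap A B P z).1, (simplexMap A B P z).2] p) refSimplex :=
    fun p => ((continuous_evalPair p).comp hS).continuousOn.integrableOn_compact
      isCompact_refSimplex
  rw [setIntegral_triangle h0, integral_add (hc _) (hc _)]
  have f1 := setIntegral_deriv_fst f A B P
  have f2 := setIntegral_deriv_snd f A B P
  have g1 := setIntegral_deriv_fst g A B P
  have g2 := setIntegral_deriv_snd g A B P
  rw [integral_add ((hc _).const_mul _) ((hc _).const_mul _), integral_const_mul,
    integral_const_mul] at f1 f2 g1 g2
  have hsign : |signedArea A B P| = Real.sign (signedArea A B P) * signedArea A B P := by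
    rcases lt_or_gt_of_ne h0 with h | h
    · rw [abs_of_neg h, Real.sign_of_neg h]
      ring
    · rw [abs_of_pos h, Real.sign_of_pos h]
      ring
  rw [hsign, mul_assoc]
  congr 1
  rw [signedArea]
  linear_combination (P.2 - A.2) * f1 - (B.2 - A.2) * f2 - (P.1 - A.1) * g1 + (B.1 - A.1) * g2

/-! ### Sides of the mesh and their normals -/

namespace Mesh
variable {K N : ℕ} {a b c d : ℝ} (M : Mesh K a b c d)

/-- Twice the signed area of the triangle spanned by a side and the opposite vertex. -/
def sideArea (e : Fin K × Fin 3) : ℝ := signedArea (M.sideA e) (M.sideB e) (M.vert e.1 e.2)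

/-- The three sides of an element list its vertices in the same cyclic order. -/
lemma sideArea_eq (e : Fin K × Fin 3) :
    M.sideArea e = signedArea (M.vert e.1 0) (M.vert e.1 1) (M.vert e.1 2) := by
  obtain ⟨k, i⟩ := e
  fin_cases i <;> simp [sideArea, signedArea, sideA, sideB] <;> ring

lemma sideArea_ne_zero (e : Fin K × Fin 3) : M.sideArea e ≠ 0 := by
  rw [sideArea_eq]
  exact signedArea_ne_zero (M.nondegenerate e.1)

lemma elem_eq_side (e : Fin K × Fin 3) :
    M.elem e.1 = convexHull ℝ {M.sideA e, M.sideB e, M.vert e.1 e.2} := by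
  rw [elem]
  congr 1
  obtain ⟨k, i⟩ := e
  ext x
  simp only [Set.mem_range, Fin.exists_fin_succ, sideA, sideB, Set.mem_insert_iff,
    Set.mem_singleton_iff]
  fin_cases i <;> simp [eq_comm] <;> tauto

lemma elem_eq (k : Fin K) :
    M.elem k = convexHull ℝ {M.vert k 0, M.vert k 1, M.vert k 2} := by
  rw [M.elem_eq_side (k, 2)]
  rfl

lemma dot_sidePerp (e : Fin K × Fin 3) :
    dot (M.sidePerp e) (M.vert e.1 e.2 - M.sideA e) = -M.sideArea e := by
  simp [dot, sidePerp, sideArea, signedArea]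
  ring

lemma sidePerp_ne_zero (e : Fin K × Fin 3) : M.sidePerp e ≠ 0 := by
  intro h
  apply M.sideArea_ne_zero e
  have := M.dot_sidePerp e
  rw [h] at this
  simpa [dot] using this.symm

lemma len_pos {v : ℝ × ℝ} (hv : v ≠ 0) : 0 < len v := by
  rw [len, Real.sqrt_pos, dot]
  by_contra h
  apply hv
  ext <;> simp only [Prod.fst_zero, Prod.snd_zero] <;> nlinarith [sq_nonneg v.1, sq_nonneg v.2]

lemma len_sidePerp (e : Fin K × Fin 3) : len (M.sidePerp e) = len (M.sideB e - M.sideA e) := by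
  simp only [len, dot, sidePerp]
  congr 1
  ring

lemma normal_eq (e : Fin K × Fin 3) :
    M.normal e = (Real.sign (M.sideArea e) / len (M.sidePerp e)) • M.sidePerp e := by
  rw [normal, dot_sidePerp, Real.sign_neg, neg_neg]

lemma normal_ne_zero (e : Fin K × Fin 3) : M.normal e ≠ 0 := by
  rw [normal_eq]
  refine smul_ne_zero (div_ne_zero ?_ (len_pos (M.sidePerp_ne_zero e)).ne') (M.sidePerp_ne_zero e)
  exact Real.sign_eq_zero_iff.not.2 (M.sideArea_ne_zero e)

lemma sideInt_eq (e : Fin K × Fin 3) (g : ℝ × ℝ → ℝ) :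
    M.sideInt e g = len (M.sidePerp e) * segInt g (M.sideA e) (M.sideB e) := by
  rw [len_sidePerp]
  rfl

variable {M}

lemma SameEdge.symm {e e' : Fin K × Fin 3} (h : M.SameEdge e e') : M.SameEdge e' e :=
  ⟨h.1.symm, h.2.symm⟩

lemma SameEdge.sideInt_eq {e e' : Fin K × Fin 3} (h : M.SameEdge e e') (g : ℝ × ℝ → ℝ) :
    M.sideInt e' g = M.sideInt e g := by
  rw [Mesh.sideInt_eq, Mesh.sideInt_eq, len_sidePerp, len_sidePerp]
  rcases Set.pair_eq_pair_iff.1 h.2 with ⟨h1, h2⟩ | ⟨h1, h2⟩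
  · rw [h1, h2]
  · rw [h1, h2, segInt_comm]
    congr 1
    simp only [len, dot, Prod.fst_sub, Prod.snd_sub]
    congr 1
    ring

/-- The outward normals of the two elements at a common edge are opposite, since the elements lie
on different sides of the edge. -/
lemma SameEdge.normal_eq_neg {e e' : Fin K × Fin 3} (h : M.SameEdge e e') :
    M.normal e' = -M.normal e := by
  have hov := M.nonoverlapping _ _ h.1
  change Disjoint (interior (M.elem e.1)) (interior (M.elem e'.1)) at hov
  have sign_of_neg : ∀ x y : ℝ, x * y < 0 → Real.sign y = -Real.sign x := by
    intro x y hxy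
    rcases mul_neg_iff.1 hxy with ⟨hx, hy⟩ | ⟨hx, hy⟩
    · rw [Real.sign_of_pos hx, Real.sign_of_neg hy]
    · rw [Real.sign_of_pos hy, Real.sign_of_neg hx, neg_neg]
  have h0 := M.sideArea_ne_zero e
  have h0' := M.sideArea_ne_zero e'
  rw [M.normal_eq, M.normal_eq]
  rw [M.elem_eq_side e, M.elem_eq_side e'] at hov
  rcases Set.pair_eq_pair_iff.1 h.2 with ⟨h1, h2⟩ | ⟨h1, h2⟩
  · have hlt : M.sideArea e * M.sideArea e' < 0 := by
      refine lt_of_le_of_ne (not_lt.1 fun hpos => ?_) (mul_ne_zero h0 h0')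
      unfold sideArea at hpos
      rw [← h1, ← h2] at hpos hov
      exact not_disjoint_interior_of_same_side hpos hov
    have hp : M.sidePerp e' = M.sidePerp e := by rw [sidePerp, sidePerp, h1, h2]
    rw [sign_of_neg _ _ hlt, hp, neg_div, neg_smul]
  · have hflip : M.sideArea e' = -signedArea (M.sideA e) (M.sideB e) (M.vert e'.1 e'.2) := by
      rw [sideArea, h1, h2]
      unfold signedArea
      ring
    have hpos : 0 < M.sideArea e * M.sideArea e' := by
      refine lt_of_le_of_ne (not_lt.1 fun hneg => ?_) (mul_ne_zero h0 h0').symm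
      rw [hflip, mul_neg, neg_lt_zero] at hneg
      rw [← h1, ← h2, Set.insert_comm (M.sideB e)] at hov
      exact not_disjoint_interior_of_same_side hneg hov
    have hp : M.sidePerp e' = -M.sidePerp e := by
      rw [sidePerp, sidePerp, h1, h2]
      ext <;> simp
    have hs : Real.sign (M.sideArea e') = Real.sign (M.sideArea e) := by
      have := sign_of_neg (M.sideArea e) (-M.sideArea e') (by linarith)
      rw [Real.sign_neg] at this
      linarith
    have hl : len (-M.sidePerp e) = len (M.sidePerp e) := by simp [len, dot]
    rw [hs, hp, hl, smul_neg]

/-- An edge belongs to at most two elements: three outward normals cannot be opposite in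
pairs. -/
lemma SameEdge.unique {e e' e'' : Fin K × Fin 3} (h : M.SameEdge e e') (h' : M.SameEdge e e'') :
    e' = e'' := by
  by_cases hk : e'.1 = e''.1
  · obtain ⟨k, i⟩ := e'
    obtain ⟨k', j⟩ := e''
    simp only at hk
    subst hk
    have hij := h.2.symm.trans h'.2
    have hinj := (M.nondegenerate k).injective
    simp only [sideA, sideB, Set.pair_eq_pair_iff, hinj.eq_iff] at hij
    have key : ∀ i j : Fin 3, i + 1 = j + 1 ∧ i + 2 = j + 2 ∨ i + 1 = j + 2 ∧ i + 2 = j + 1 →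
        i = j := by decide
    rw [key i j hij]
  · exfalso
    have h3 : M.SameEdge e' e'' := ⟨hk, h.2.symm.trans h'.2⟩
    have n1 := h.normal_eq_neg
    have n2 := h'.normal_eq_neg
    have n3 := h3.normal_eq_neg
    rw [n1, n2, neg_neg] at n3
    exact M.normal_ne_zero e (self_eq_neg.1 n3.symm)

end Mesh

/-! ### Outflow through the sides and the central fluxes -/

lemma Vh.continuous_val {K N : ℕ} (v : Vh K N) (k : Fin K) : Continuous (v.val k) :=
  continuous_evalPair _

lemma Vh.continuous_partialDeriv {K N : ℕ} (i : Fin 2) (v : Vh K N) (k : Fin K) :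
    Continuous (v.partialDeriv i k) :=
  continuous_evalPair _

namespace Mesh
variable {K N : ℕ} {a b c d : ℝ} (M : Mesh K a b c d)

lemma isCompact_elem (k : Fin K) : IsCompact (M.elem k) :=
  (Set.finite_range _).isCompact_convexHull ℝ

lemma measurableSet_elem (k : Fin K) : MeasurableSet (M.elem k) :=
  (M.isCompact_elem k).isClosed.measurableSet

lemma integrableOn_elem {F : ℝ × ℝ → ℝ} (hF : Continuous F) (k : Fin K) :
    IntegrableOn F (M.elem k) :=
  hF.continuousOn.integrableOn_compact (M.isCompact_elem k)

lemma intervalIntegrable_side {g : ℝ × ℝ → ℝ} (hg : Continuous g) (A B : ℝ × ℝ) :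
    IntervalIntegrable (fun s : ℝ => g (A + s • (B - A))) volume 0 1 :=
  Continuous.intervalIntegrable (by fun_prop) _ _

lemma sideInt_add (e : Fin K × Fin 3) {g h : ℝ × ℝ → ℝ} (hg : Continuous g) (hh : Continuous h) :
    M.sideInt e (fun x => g x + h x) = M.sideInt e g + M.sideInt e h := by
  simp only [sideInt]
  rw [intervalIntegral.integral_add (intervalIntegrable_side hg _ _)
    (intervalIntegrable_side hh _ _), mul_add]

lemma sideInt_const_mul (e : Fin K × Fin 3) (r : ℝ) (g : ℝ × ℝ → ℝ) :
    M.sideInt e (fun x => r * g x) = r * M.sideInt e g := by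
  simp only [sideInt]
  rw [intervalIntegral.integral_const_mul]
  ring

/-- The outward flux density `u q · n` of the element that carries the side `e`. -/
noncomputable def outflow (u : Vh K N) (q : Vh K N × Vh K N) (e : Fin K × Fin 3)
    (x : ℝ × ℝ) : ℝ := u.val e.1 x * dot (M.trace q e x) (M.normal e)

lemma continuous_outflow (u : Vh K N) (q : Vh K N × Vh K N) (e : Fin K × Fin 3) :
    Continuous (M.outflow u q e) := by
  have h0 := u.continuous_val e.1
  have h1 := q.1.continuous_val e.1
  have h2 := q.2.continuous_val e.1
  unfold outflow dot trace
  fun_prop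

lemma sideInt_outflow (u : Vh K N) (q : Vh K N × Vh K N) (e : Fin K × Fin 3) :
    M.sideInt e (M.outflow u q e) = Real.sign (M.sideArea e) *
      (((M.sideB e).2 - (M.sideA e).2) *
          segInt (fun x => u.val e.1 x * q.1.val e.1 x) (M.sideA e) (M.sideB e) -
        ((M.sideB e).1 - (M.sideA e).1) *
          segInt (fun x => u.val e.1 x * q.2.val e.1 x) (M.sideA e) (M.sideB e)) := by
  have h0 := u.continuous_val e.1
  have h1 := q.1.continuous_val e.1
  have h2 := q.2.continuous_val e.1
  have hl := (len_pos (M.sidePerp_ne_zero e)).ne'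
  have : M.outflow u q e = fun x =>
      (Real.sign (M.sideArea e) / len (M.sidePerp e) * ((M.sideB e).2 - (M.sideA e).2)) *
        (u.val e.1 x * q.1.val e.1 x) +
      (-(Real.sign (M.sideArea e) / len (M.sidePerp e) * ((M.sideB e).1 - (M.sideA e).1))) *
        (u.val e.1 x * q.2.val e.1 x) := by
    ext x
    simp only [outflow, trace, dot, M.normal_eq, sidePerp, Prod.smul_fst, Prod.smul_snd,
      smul_eq_mul, Prod.fst_sub, Prod.snd_sub]
    ring
  rw [this, sideInt_add _ _ (by fun_prop) (by fun_prop), sideInt_const_mul, sideInt_const_mul,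
    sideInt_eq, sideInt_eq]
  field_simp
  ring

/-- The divergence theorem on one element, for the field `u q`. -/
lemma integral_elem_divergence (u : Vh K N) (q : Vh K N × Vh K N) (k : Fin K) :
    ∫ x in M.elem k, (q.1.val k x * u.partialDeriv 0 k x + q.2.val k x * u.partialDeriv 1 k x +
        u.val k x * (q.1.partialDeriv 0 k x + q.2.partialDeriv 1 k x)) =
      ∑ i, M.sideInt (k, i) (M.outflow u q (k, i)) := by
  have h := divergence_triangle ((u k : MvPolynomial (Fin 2) ℝ) * q.1 k)
    ((u k : MvPolynomial (Fin 2) ℝ) * q.2 k) (M.sideArea_eq (k, 0) ▸ M.sideArea_ne_zero (k, 0))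
  simp only [Fin.sum_univ_three, sideInt_outflow, M.sideArea_eq]
  rw [M.elem_eq]
  simp only [MvPolynomial.pderiv_mul, map_add, map_mul] at h
  have e : ∀ x, q.1.val k x * u.partialDeriv 0 k x + q.2.val k x * u.partialDeriv 1 k x +
        u.val k x * (q.1.partialDeriv 0 k x + q.2.partialDeriv 1 k x) =
      MvPolynomial.eval ![x.1, x.2] (MvPolynomial.pderiv 0 (u k : MvPolynomial (Fin 2) ℝ)) *
        MvPolynomial.eval ![x.1, x.2] (q.1 k : MvPolynomial (Fin 2) ℝ) +
      MvPolynomial.eval ![x.1, x.2] (u k : MvPolynomial (Fin 2) ℝ) *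
        MvPolynomial.eval ![x.1, x.2] (MvPolynomial.pderiv 0 (q.1 k : MvPolynomial (Fin 2) ℝ)) +
      (MvPolynomial.eval ![x.1, x.2] (MvPolynomial.pderiv 1 (u k : MvPolynomial (Fin 2) ℝ)) *
        MvPolynomial.eval ![x.1, x.2] (q.2 k : MvPolynomial (Fin 2) ℝ) +
      MvPolynomial.eval ![x.1, x.2] (u k : MvPolynomial (Fin 2) ℝ) *
        MvPolynomial.eval ![x.1, x.2] (MvPolynomial.pderiv 1 (q.2 k : MvPolynomial (Fin 2) ℝ)))
        := by
    intro x
    simp only [Vh.val, Vh.partialDeriv]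
    ring
  simp only [e]
  rw [h]
  have s0 : M.sideA (k, 0) = M.vert k 1 := rfl
  have s1 : M.sideB (k, 0) = M.vert k 2 := rfl
  have s2 : M.sideA (k, 1) = M.vert k 2 := rfl
  have s3 : M.sideB (k, 1) = M.vert k 0 := rfl
  have s4 : M.sideA (k, 2) = M.vert k 0 := rfl
  have s5 : M.sideB (k, 2) = M.vert k 1 := rfl
  rw [s0, s1, s2, s3, s4, s5]
  simp only [Vh.val]
  ring

open Classical in
/-- Summation over internal edges: each side with a neighbour is met exactly once as first member
of a pair, because the neighbour is unique. -/
lemma sum_internalPairs_add (S : Fin K × Fin 3 → ℝ) :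
    (1 / 2) * ∑ e ∈ M.internalPairs, (S e.1 + S e.2) + ∑ e ∈ M.externalSides, S e = ∑ e, S e := by
  have hfst : ∑ e ∈ M.internalPairs, S e.1 =
      ∑ e, if ∃ e', M.SameEdge e e' then S e else 0 := by
    rw [internalPairs, Finset.sum_filter, Fintype.sum_prod_type]
    refine Finset.sum_congr rfl fun e _ => ?_
    by_cases h : ∃ e', M.SameEdge e e'
    · obtain ⟨e', he'⟩ := h
      rw [if_pos ⟨e', he'⟩, Finset.sum_eq_single e']
      · simp [he']
      · intro e'' _ hne
        exact if_neg fun h'' => hne (h''.unique he')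
      · simp
    · rw [if_neg h]
      exact Finset.sum_eq_zero fun e' _ => if_neg fun h' => h ⟨e', h'⟩
  have hsnd : ∑ e ∈ M.internalPairs, S e.2 = ∑ e ∈ M.internalPairs, S e.1 := by
    refine Finset.sum_equiv (Equiv.prodComm _ _) (fun e => ?_) (fun e _ => rfl)
    simp only [internalPairs, Finset.mem_filter, Finset.mem_univ, true_and, Equiv.prodComm_apply,
      Prod.fst_swap, Prod.snd_swap]
    exact ⟨SameEdge.symm, SameEdge.symm⟩
  rw [Finset.sum_add_distrib, hsnd, hfst, externalSides, Finset.sum_filter, ← two_mul, ← mul_assoc,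
    one_div, inv_mul_cancel₀ two_ne_zero, one_mul, ← Finset.sum_add_distrib]
  refine Finset.sum_congr rfl fun e _ => ?_
  by_cases h : ∃ e', M.SameEdge e e'
  · rw [if_pos h, if_neg (by simpa using h), add_zero]
  · rw [if_neg h, if_pos (by simpa using h), zero_add]

/-- On an internal edge the two central flux terms add up to the outflows of both elements. -/
lemma flux_add_flux (u : Vh K N) (q : Vh K N × Vh K N) {e e' : Fin K × Fin 3}
    (h : M.SameEdge e e') (x : ℝ × ℝ) :
    dot (M.fluxQ q e e' x) (M.jump u e e' x) + M.fluxU u e e' x * M.jumpVec q e e' x =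
      M.outflow u q e x + M.outflow u q e' x := by
  simp only [fluxQ, jump, fluxU, jumpVec, outflow, trace, h.normal_eq_neg, dot, Prod.smul_fst,
    Prod.smul_snd, Prod.fst_add, Prod.snd_add, Prod.fst_neg, Prod.snd_neg, smul_eq_mul]
  ring

lemma continuous_fluxQ_jump (u : Vh K N) (q : Vh K N × Vh K N) (e e' : Fin K × Fin 3) :
    Continuous fun x => dot (M.fluxQ q e e' x) (M.jump u e e' x) := by
  have := u.continuous_val e.1
  have := u.continuous_val e'.1
  have := q.1.continuous_val e.1
  have := q.1.continuous_val e'.1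
  have := q.2.continuous_val e.1
  have := q.2.continuous_val e'.1
  simp only [fluxQ, jump, trace, dot, Prod.smul_fst,
    Prod.smul_snd, Prod.fst_add, Prod.snd_add, smul_eq_mul]
  fun_prop

lemma continuous_fluxU_jumpVec (u : Vh K N) (q : Vh K N × Vh K N) (e e' : Fin K × Fin 3) :
    Continuous fun x => M.fluxU u e e' x * M.jumpVec q e e' x := by
  have := u.continuous_val e.1
  have := u.continuous_val e'.1
  have := q.1.continuous_val e.1
  have := q.1.continuous_val e'.1
  have := q.2.continuous_val e.1
  have := q.2.continuous_val e'.1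
  simp only [fluxU, jumpVec, trace, dot]
  fun_prop

/-- Elementwise integration by parts: with central fluxes, the flux terms of the scheme are exactly
the boundary terms of all elements. -/
theorem fluxTermQ_add_fluxTermU (u : Vh K N) (q : Vh K N × Vh K N) :
    M.fluxTermQ q u + M.fluxTermU u q =
      M.inner q.1.val (u.partialDeriv 0) + M.inner q.2.val (u.partialDeriv 1) +
        M.inner u.val (fun k x => q.1.partialDeriv 0 k x + q.2.partialDeriv 1 k x) := by
  have hR : M.inner q.1.val (u.partialDeriv 0) + M.inner q.2.val (u.partialDeriv 1) +
        M.inner u.val (fun k x => q.1.partialDeriv 0 k x + q.2.partialDeriv 1 k x) =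
      ∑ e, M.sideInt e (M.outflow u q e) := by
    rw [Fintype.sum_prod_type]
    simp only [← M.integral_elem_divergence, inner]
    rw [← Finset.sum_add_distrib, ← Finset.sum_add_distrib]
    refine Finset.sum_congr rfl fun k _ => ?_
    have c0 := u.continuous_val k
    have c1 := q.1.continuous_val k
    have c2 := q.2.continuous_val k
    have d0 := u.continuous_partialDeriv 0 k
    have d1 := u.continuous_partialDeriv 1 k
    have d2 := q.1.continuous_partialDeriv 0 k
    have d3 := q.2.continuous_partialDeriv 1 k
    rw [integral_add, integral_add] <;> exact M.integrableOn_elem (by fun_prop) k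
  rw [hR, ← M.sum_internalPairs_add fun e => M.sideInt e (M.outflow u q e), fluxTermQ, fluxTermU,
    intInternal, intInternal, intExternal, add_right_comm, ← mul_add, ← Finset.sum_add_distrib]
  congr 1
  · congr 1
    refine Finset.sum_congr rfl fun p hp => ?_
    have hp : M.SameEdge p.1 p.2 := by
      simpa [internalPairs] using hp
    rw [← M.sideInt_add _ (M.continuous_fluxQ_jump u q _ _) (M.continuous_fluxU_jumpVec u q _ _)]
    simp only [M.flux_add_flux u q hp]
    rw [M.sideInt_add _ (M.continuous_outflow _ _ _) (M.continuous_outflow _ _ _), hp.sideInt_eq]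
  · refine Finset.sum_congr rfl fun e _ => ?_
    congr 1
    ext x
    simp only [outflow, dot, Prod.smul_fst, Prod.smul_snd, smul_eq_mul]
    ring

end Mesh

/-! ### Fractional integrals of functions on a rectangle -/

/-- Positivity of the pairing; it is not a consequence of `negSobolevNorm_sq`, where
`ENNReal.ofReal` truncates at `0`. -/
lemma leftFracInt_mul_self_nonneg {a b C s : ℝ} {g : ℝ → ℝ} (hs0 : 0 ≤ s) (hs1 : s < 1)
    (hm : Measurable g) (hC : ∀ x, |g x| ≤ C) (hsupp : ∀ x ∉ Set.Icc a b, g x = 0) :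
    0 ≤ ∫ x, leftFracInt a s g x * g x := by
  rcases hs0.eq_or_lt with rfl | hs
  · have : ∀ x, leftFracInt a 0 g x = g x := fun x => if_pos rfl
    simp only [this]
    exact integral_nonneg fun x => mul_self_nonneg (g x)
  · have hg := integrable_of_bounded_of_support hm hC hsupp
    have hG1 : 0 < Real.Gamma s := Real.Gamma_pos_of_pos (by linarith)
    have hG2 : 0 < Real.Gamma ((1 - s) / 2) := Real.Gamma_pos_of_pos (by linarith)
    rw [integral_leftFracInt_mul_self hs hs1 hm hC hsupp]
    refine mul_nonneg (by positivity) (nonneg_of_mul_nonneg_right ?_ hG2)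
    rw [← (integral_gaussian_superposition hs hs1 hm hC hsupp).2]
    refine setIntegral_nonneg measurableSet_Ioi fun l hl => ?_
    have hl : 0 < l := hl
    refine mul_nonneg (by positivity) ?_
    have h := gaussian_fourierHat hg hl
    refine nonneg_of_mul_nonneg_right ?_ (Real.sqrt_pos.2 (div_pos hl Real.pi_pos))
    rw [← h]
    exact integral_nonneg fun ω => by positivity

/-- Integrability of the fractional integral at a point, with a bound uniform in `x ≤ b`. -/
lemma integrable_leftKernel_slice {a b C s : ℝ} {g : ℝ → ℝ} (hs0 : 0 < s) (hm : Measurable g)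
    (hC : ∀ x, |g x| ≤ C) (hsupp : ∀ x ∉ Set.Icc a b, g x = 0) {x : ℝ} (hx : x ≤ b) :
    Integrable (fun ξ => leftKernel s (x - ξ) * g ξ) ∧
    |∫ ξ, leftKernel s (x - ξ) * g ξ| ≤ (∫ z, (Set.Iic (b - a)).indicator (leftKernel s) z) * C := by
  have h1 := (integrable_leftKernel_indicator hs0 (b - a)).comp_sub_left x
  have heq : ∀ ξ, (Set.Iic (b - a)).indicator (leftKernel s) (x - ξ) * g ξ =
      leftKernel s (x - ξ) * g ξ := by
    intro ξ
    by_cases hξ : ξ ∈ Set.Icc a b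
    · rw [Set.indicator_of_mem (by simp only [Set.mem_Iic]; linarith [hξ.1])]
    · simp [hsupp ξ hξ]
  have h2 := h1.mul_bdd (g := g) (c := C) hm.aestronglyMeasurable (Filter.Eventually.of_forall hC)
  simp only [heq] at h2
  refine ⟨h2, ?_⟩
  rw [← integral_sub_left_eq_self ((Set.Iic (b - a)).indicator (leftKernel s)) volume x,
    ← integral_mul_const, ← Real.norm_eq_abs]
  refine norm_integral_le_of_norm_le (h1.mul_const C) (Filter.Eventually.of_forall fun ξ => ?_)
  rw [← heq, norm_mul, Real.norm_of_nonneg (Set.indicator_nonneg (fun z _ => leftKernel_nonneg s z) _)]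
  exact mul_le_mul_of_nonneg_left (hC ξ)
    (Set.indicator_nonneg (fun z _ => leftKernel_nonneg s z) _)

/-- Bounded measurable functions on the plane that vanish outside the rectangle
`[a,b] × [c,d]`. -/
structure BoundedOnRect (a b c d : ℝ) (h : ℝ × ℝ → ℝ) : Prop where
  measurable : Measurable h
  bounded : ∃ C, ∀ x, |h x| ≤ C
  support : ∀ x ∉ Set.Icc a b ×ˢ Set.Icc c d, h x = 0

/-- The left fractional integral in the first variable of a function on the plane. -/
noncomputable def fracFst (a s : ℝ) (h : ℝ × ℝ → ℝ) (x : ℝ × ℝ) : ℝ :=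
  leftFracInt a s (fun ξ => h (ξ, x.2)) x.1

namespace BoundedOnRect
variable {a b c d s : ℝ} {h h' : ℝ × ℝ → ℝ}

lemma swap (hh : BoundedOnRect a b c d h) : BoundedOnRect c d a b (h ∘ Prod.swap) where
  measurable := hh.measurable.comp measurable_swap
  bounded := hh.bounded.imp fun _ hC x => hC x.swap
  support _ hx := hh.support _ fun hx' => hx ⟨hx'.2, hx'.1⟩

lemma measurable_slice (hh : BoundedOnRect a b c d h) (y : ℝ) : Measurable fun ξ => h (ξ, y) :=
  hh.measurable.comp (by fun_prop)

lemma support_slice (hh : BoundedOnRect a b c d h) (y : ℝ) :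
    ∀ ξ ∉ Set.Icc a b, h (ξ, y) = 0 :=
  fun _ hξ => hh.support _ fun hx => hξ hx.1

lemma fracFst_eq (hh : BoundedOnRect a b c d h) (hs0 : 0 < s) (hs1 : s < 1) {x : ℝ × ℝ}
    (hx : a ≤ x.1) :
    fracFst a s h x = 1 / Real.Gamma s * ∫ ξ, leftKernel s (x.1 - ξ) * h (ξ, x.2) :=
  leftFracInt_eq_integral_leftKernel hs0 hs1 hx fun ξ hξ =>
    hh.support_slice x.2 ξ fun hm => absurd hm.1 (not_le.2 hξ)

lemma fracFst_add (hh : BoundedOnRect a b c d h) (hh' : BoundedOnRect a b c d h')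
    (hadd : BoundedOnRect a b c d (fun x => h x + h' x)) (hs0 : 0 ≤ s) (hs1 : s < 1) {x : ℝ × ℝ}
    (hx : x ∈ Set.Icc a b ×ˢ Set.Icc c d) :
    fracFst a s (fun x => h x + h' x) x = fracFst a s h x + fracFst a s h' x := by
  rcases hs0.eq_or_lt with rfl | hs
  · simp [fracFst, leftFracInt]
  · obtain ⟨C, hC⟩ := hh.bounded
    obtain ⟨C', hC'⟩ := hh'.bounded
    rw [hadd.fracFst_eq hs hs1 hx.1.1, hh.fracFst_eq hs hs1 hx.1.1, hh'.fracFst_eq hs hs1 hx.1.1,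
      ← mul_add, ← integral_add
        (integrable_leftKernel_slice hs (hh.measurable_slice x.2) (fun ξ => hC _)
          (hh.support_slice x.2) hx.1.2).1
        (integrable_leftKernel_slice hs (hh'.measurable_slice x.2) (fun ξ => hC' _)
          (hh'.support_slice x.2) hx.1.2).1]
    congr 2
    ext ξ
    ring

lemma fracFst_const_mul (r : ℝ) (h : ℝ × ℝ → ℝ) (x : ℝ × ℝ) :
    fracFst a s (fun x => r * h x) x = r * fracFst a s h x := by
  simp only [fracFst, leftFracInt]
  split_ifs
  · rfl
  · have e : ∀ ξ, (x.1 - ξ) ^ (s - 1) * (r * h (ξ, x.2)) =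
        r * ((x.1 - ξ) ^ (s - 1) * h (ξ, x.2)) := fun ξ => by ring
    simp only [e, intervalIntegral.integral_const_mul]
    ring

lemma integrableOn_fracFst (hh : BoundedOnRect a b c d h) (hs0 : 0 ≤ s) (hs1 : s < 1) :
    IntegrableOn (fracFst a s h) (Set.Icc a b ×ˢ Set.Icc c d) := by
  obtain ⟨C, hC⟩ := hh.bounded
  have hmeas : MeasurableSet (Set.Icc a b ×ˢ Set.Icc c d) := measurableSet_Icc.prod measurableSet_Icc
  have hfin : volume (Set.Icc a b ×ˢ Set.Icc c d) ≠ ⊤ :=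
    (isCompact_Icc.prod isCompact_Icc).measure_lt_top.ne
  rcases hs0.eq_or_lt with rfl | hs
  · have : fracFst a 0 h = h := by
      ext x
      simp [fracFst, leftFracInt]
    rw [this]
    exact Measure.integrableOn_of_bounded (M := C) hfin hh.measurable.aestronglyMeasurable
      (Filter.Eventually.of_forall hC)
  · have hsm : StronglyMeasurable fun x : ℝ × ℝ =>
        1 / Real.Gamma s * ∫ ξ, leftKernel s (x.1 - ξ) * h (ξ, x.2) := by
      have : Measurable fun y : (ℝ × ℝ) × ℝ => leftKernel s (y.1.1 - y.2) * h (y.2, y.1.2) :=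
        ((measurable_leftKernel s).comp (by fun_prop)).mul (hh.measurable.comp (by fun_prop))
      exact this.stronglyMeasurable.integral_prod_right.const_mul _
    have hi : IntegrableOn (fun x : ℝ × ℝ =>
        1 / Real.Gamma s * ∫ ξ, leftKernel s (x.1 - ξ) * h (ξ, x.2))
        (Set.Icc a b ×ˢ Set.Icc c d) := by
      refine Measure.integrableOn_of_bounded (M := |1 / Real.Gamma s| *
        ((∫ z, (Set.Iic (b - a)).indicator (leftKernel s) z) * C)) hfin
        hsm.aestronglyMeasurable ?_
      filter_upwards [ae_restrict_mem hmeas] with x hx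
      rw [norm_mul]
      refine mul_le_mul_of_nonneg_left ?_ (norm_nonneg _)
      exact (integrable_leftKernel_slice hs (hh.measurable_slice x.2) (fun ξ => hC _)
          (hh.support_slice x.2) hx.1.2).2
    exact hi.congr_fun (fun x hx => (hh.fracFst_eq hs hs1 hx.1.1).symm) hmeas

lemma integrable_mul (hh : BoundedOnRect a b c d h) {F : ℝ × ℝ → ℝ}
    (hF : IntegrableOn F (Set.Icc a b ×ˢ Set.Icc c d)) : Integrable fun x => F x * h x := by
  obtain ⟨C, hC⟩ := hh.bounded
  have hmeas : MeasurableSet (Set.Icc a b ×ˢ Set.Icc c d) := measurableSet_Icc.prod measurableSet_Icc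
  have h1 := (hF.integrable_indicator hmeas).mul_bdd (c := C) hh.measurable.aestronglyMeasurable
    (Filter.Eventually.of_forall hC)
  refine h1.congr (Filter.Eventually.of_forall fun x => ?_)
  by_cases hx : x ∈ Set.Icc a b ×ˢ Set.Icc c d
  · simp only [Set.indicator_of_mem hx]
  · simp [hh.support x hx]

/-- The two-dimensional form of the energy identity, obtained by integrating over the slices. -/
theorem lintegral_negSobolevNorm_sq (hh : BoundedOnRect a b c d h) (hs0 : 0 ≤ s) (hs1 : s < 1)
    (hcont : ∀ y, ∀ᵐ x, ContinuousAt (fun ξ => h (ξ, y)) x) :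
    0 ≤ ∫ x, fracFst a s h x * h x ∧
    ∫⁻ y in Set.Ioo c d, negSobolevNorm (s / 2) (fun ξ => h (ξ, y)) ^ 2 =
      ENNReal.ofReal ((∫ x, fracFst a s h x * h x) / Real.cos (s * Real.pi / 2)) := by
  obtain ⟨C, hC⟩ := hh.bounded
  have hcos := cos_half_pos hs0 hs1
  have hint := hh.integrable_mul (hh.integrableOn_fracFst hs0 hs1)
  have hnn : ∀ y, 0 ≤ ∫ x, fracFst a s h (x, y) * h (x, y) := fun y =>
    leftFracInt_mul_self_nonneg hs0 hs1 (hh.measurable_slice y) (fun ξ => hC _)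
      (hh.support_slice y)
  have hF : ∫ x, fracFst a s h x * h x = ∫ y, ∫ x, fracFst a s h (x, y) * h (x, y) := by
    rw [Measure.volume_eq_prod]
    exact integral_prod_symm _ hint
  have hFi : Integrable fun y => ∫ x, fracFst a s h (x, y) * h (x, y) := hint.integral_prod_right
  constructor
  · rw [hF]
    exact integral_nonneg hnn
  · have h1 : ∀ y, negSobolevNorm (s / 2) (fun ξ => h (ξ, y)) ^ 2 =
        ENNReal.ofReal ((∫ x, fracFst a s h (x, y) * h (x, y)) / Real.cos (s * Real.pi / 2)) :=
      fun y => negSobolevNorm_sq hs0 hs1 (hh.measurable_slice y) (fun ξ => hC _)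
        (hh.support_slice y) (hcont y)
    simp only [h1]
    rw [hF, ← integral_div, ofReal_integral_eq_lintegral_ofReal (hFi.div_const _)
      (Filter.Eventually.of_forall fun y => div_nonneg (hnn y) hcos.le),
      setLIntegral_congr Ioo_ae_eq_Icc, ← lintegral_indicator measurableSet_Icc]
    refine lintegral_congr fun y => ?_
    by_cases hy : y ∈ Set.Icc c d
    · rw [Set.indicator_of_mem hy]
    · have : ∀ x, h (x, y) = 0 := fun x => hh.support _ fun hx => hy hx.2
      simp [Set.indicator_of_notMem hy, this]

end BoundedOnRect

/-! ### The bilinear forms of the scheme -/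

lemma Vh.val_add {K N : ℕ} (v w : Vh K N) (k : Fin K) (x : ℝ × ℝ) :
    (v + w).val k x = v.val k x + w.val k x := by simp [Vh.val]

lemma Vh.val_smul {K N : ℕ} (r : ℝ) (v : Vh K N) (k : Fin K) (x : ℝ × ℝ) :
    (r • v).val k x = r * v.val k x := by simp [Vh.val]

lemma Vh.partialDeriv_add {K N : ℕ} (i : Fin 2) (v w : Vh K N) (k : Fin K) (x : ℝ × ℝ) :
    (v + w).partialDeriv i k x = v.partialDeriv i k x + w.partialDeriv i k x := by
  simp [Vh.partialDeriv]

lemma Vh.partialDeriv_smul {K N : ℕ} (i : Fin 2) (r : ℝ) (v : Vh K N) (k : Fin K) (x : ℝ × ℝ) :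
    (r • v).partialDeriv i k x = r * v.partialDeriv i k x := by simp [Vh.partialDeriv]

namespace Mesh
variable {K N : ℕ} {a b c d : ℝ} (M : Mesh K a b c d)

lemma elem_subset (k : Fin K) : M.elem k ⊆ Set.Icc a b ×ˢ Set.Icc c d := by
  rw [← M.fills]
  exact Set.subset_iUnion (fun k => convexHull ℝ (Set.range (M.vert k))) k

lemma toFun_add (v w : Vh K N) (x : ℝ × ℝ) : M.toFun (v + w) x = M.toFun v x + M.toFun w x := by
  simp only [toFun, ← Finset.sum_add_distrib]
  refine Finset.sum_congr rfl fun k _ => ?_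
  by_cases hx : x ∈ interior (M.elem k) <;> simp [hx, Vh.val_add]

lemma toFun_smul (r : ℝ) (v : Vh K N) (x : ℝ × ℝ) : M.toFun (r • v) x = r * M.toFun v x := by
  simp only [toFun, Finset.mul_sum]
  refine Finset.sum_congr rfl fun k _ => ?_
  by_cases hx : x ∈ interior (M.elem k) <;> simp [hx, Vh.val_smul]

lemma boundedOnRect_toFun (v : Vh K N) : BoundedOnRect a b c d (M.toFun v) where
  measurable := by
    unfold toFun
    exact Finset.measurable_fun_sum _ fun k _ =>
      (v.continuous_val k).measurable.indicator isOpen_interior.measurableSet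
  bounded := by
    have : ∀ k, ∃ C, ∀ x ∈ M.elem k, ‖v.val k x‖ ≤ C := fun k =>
      (M.isCompact_elem k).exists_bound_of_continuousOn (v.continuous_val k).continuousOn
    choose C hC using this
    refine ⟨∑ k, |C k|, fun x => (Finset.abs_sum_le_sum_abs _ _).trans ?_⟩
    refine Finset.sum_le_sum fun k _ => ?_
    by_cases hx : x ∈ interior (M.elem k)
    · rw [Set.indicator_of_mem hx]
      exact (hC k x (interior_subset hx)).trans (le_abs_self _)
    · rw [Set.indicator_of_notMem hx, abs_zero]
      exact abs_nonneg _
  support x hx := Finset.sum_eq_zero fun k _ =>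
    Set.indicator_of_notMem (fun h => hx (M.elem_subset k (interior_subset h))) _

/-- A line meets each element in an interval, so `v` is continuous along the line at almost every
point of it. -/
lemma ae_continuousAt_toFun_comp (v : Vh K N) {φ : ℝ → ℝ × ℝ} (hφ : Continuous φ)
    (haff : ∀ x y p q : ℝ, p + q = 1 → φ (p * x + q * y) = p • φ x + q • φ y) :
    ∀ᵐ x, ContinuousAt (fun x => M.toFun v (φ x)) x := by
  have hconv : ∀ k, Convex ℝ (φ ⁻¹' interior (M.elem k)) := by
    intro k x hx y hy p q hp hq hpq
    rw [Set.mem_preimage, smul_eq_mul, smul_eq_mul, haff x y p q hpq]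
    exact (convex_convexHull ℝ _).interior hx hy hp hq hpq
  have hae : ∀ᵐ x, ∀ k, x ∉ frontier (φ ⁻¹' interior (M.elem k)) :=
    ae_all_iff.2 fun k => measure_eq_zero_iff_ae_notMem.1 ((hconv k).addHaar_frontier volume)
  filter_upwards [hae] with x hx
  unfold toFun
  refine tendsto_finsetSum _ fun k _ => ?_
  exact ContinuousOn.continuousAt_indicator (f := fun x => v.val k (φ x))
    (((v.continuous_val k).comp hφ).continuousOn) (hx k)

/-- The broken inner product with `v ∈ V_h` is an integral over the plane. -/
lemma inner_val_eq_integral (v : Vh K N) {F : ℝ × ℝ → ℝ}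
    (hF : IntegrableOn F (Set.Icc a b ×ˢ Set.Icc c d)) :
    M.inner (fun _ => F) v.val = ∫ x, F x * M.toFun v x := by
  have hk : ∀ k, ∫ x in M.elem k, F x * v.val k x =
      ∫ x, (interior (M.elem k)).indicator (fun x => F x * v.val k x) x := by
    intro k
    rw [integral_indicator isOpen_interior.measurableSet]
    exact setIntegral_congr_set (interior_ae_eq_of_null_frontier
      ((convex_convexHull ℝ _).addHaar_frontier volume)).symm
  have hi : ∀ k, Integrable ((interior (M.elem k)).indicator (fun x => F x * v.val k x)) := by
    intro k
    rw [integrable_indicator_iff isOpen_interior.measurableSet]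
    exact ((hF.mono_set (M.elem_subset k)).mul_continuousOn (v.continuous_val k).continuousOn
      (M.isCompact_elem k)).mono_set interior_subset
  rw [inner]
  simp only [hk]
  rw [← integral_finsetSum _ fun k _ => hi k]
  congr 1
  ext x
  rw [toFun, Finset.mul_sum]
  refine Finset.sum_congr rfl fun k _ => ?_
  by_cases hx : x ∈ interior (M.elem k) <;> simp [hx]

lemma inner_add_left {F F' G : Fin K → ℝ × ℝ → ℝ} (hF : ∀ k, IntegrableOn (F k) (M.elem k))
    (hF' : ∀ k, IntegrableOn (F' k) (M.elem k)) (hG : ∀ k, Continuous (G k)) :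
    M.inner (fun k x => F k x + F' k x) G = M.inner F G + M.inner F' G := by
  simp only [inner, ← Finset.sum_add_distrib]
  refine Finset.sum_congr rfl fun k _ => ?_
  rw [← integral_add ((hF k).mul_continuousOn (hG k).continuousOn (M.isCompact_elem k))
    ((hF' k).mul_continuousOn (hG k).continuousOn (M.isCompact_elem k))]
  congr 1
  ext x
  ring

lemma inner_add_right {F G G' : Fin K → ℝ × ℝ → ℝ} (hF : ∀ k, IntegrableOn (F k) (M.elem k))
    (hG : ∀ k, Continuous (G k)) (hG' : ∀ k, Continuous (G' k)) :
    M.inner F (fun k x => G k x + G' k x) = M.inner F G + M.inner F G' := by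
  simp only [inner, ← Finset.sum_add_distrib]
  refine Finset.sum_congr rfl fun k _ => ?_
  rw [← integral_add ((hF k).mul_continuousOn (hG k).continuousOn (M.isCompact_elem k))
    ((hF k).mul_continuousOn (hG' k).continuousOn (M.isCompact_elem k))]
  congr 1
  ext x
  ring

lemma inner_const_mul_left (r : ℝ) (F G : Fin K → ℝ × ℝ → ℝ) :
    M.inner (fun k x => r * F k x) G = r * M.inner F G := by
  simp only [inner, Finset.mul_sum, ← integral_const_mul, mul_assoc]

lemma inner_const_mul_right (r : ℝ) (F G : Fin K → ℝ × ℝ → ℝ) :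
    M.inner F (fun k x => r * G k x) = r * M.inner F G := by
  simp only [inner, Finset.mul_sum, ← integral_const_mul, mul_left_comm]

lemma inner_congr_left {F F' : Fin K → ℝ × ℝ → ℝ} (h : ∀ k, Set.EqOn (F k) (F' k) (M.elem k))
    (G : Fin K → ℝ × ℝ → ℝ) : M.inner F G = M.inner F' G := by
  refine Finset.sum_congr rfl fun k _ => setIntegral_congr_fun (M.measurableSet_elem k) ?_
  intro x hx
  simp only [h k hx]

lemma inner_comm (F G : Fin K → ℝ × ℝ → ℝ) : M.inner F G = M.inner G F := by
  simp only [inner, mul_comm]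

/-- The `L²(Ω)` inner product on `V_h`. -/
noncomputable def massForm : Vh K N →ₗ[ℝ] Vh K N →ₗ[ℝ] ℝ :=
  LinearMap.mk₂ ℝ (fun v w => M.inner v.val w.val)
    (fun v v' w => by
      rw [← M.inner_add_left (fun k => M.integrableOn_elem (v.continuous_val k) k)
        (fun k => M.integrableOn_elem (v'.continuous_val k) k) w.continuous_val]
      congr 1
      ext k x
      exact Vh.val_add v v' k x)
    (fun r v w => by
      rw [smul_eq_mul, ← inner_const_mul_left]
      congr 1
      ext k x
      exact Vh.val_smul r v k x)
    (fun v w w' => by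
      rw [← M.inner_add_right (fun k => M.integrableOn_elem (v.continuous_val k) k)
        w.continuous_val w'.continuous_val]
      congr 1
      ext k x
      exact Vh.val_add w w' k x)
    (fun r v w => by
      rw [smul_eq_mul, ← inner_const_mul_right]
      congr 1
      ext k x
      exact Vh.val_smul r w k x)

/-- The form `(v, ∂_i w)` with the elementwise partial derivative. -/
noncomputable def derivForm (i : Fin 2) : Vh K N →ₗ[ℝ] Vh K N →ₗ[ℝ] ℝ :=
  LinearMap.mk₂ ℝ (fun v w => M.inner v.val (w.partialDeriv i))
    (fun v v' w => by
      rw [← M.inner_add_left (fun k => M.integrableOn_elem (v.continuous_val k) k)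
        (fun k => M.integrableOn_elem (v'.continuous_val k) k) (w.continuous_partialDeriv i)]
      congr 1
      ext k x
      exact Vh.val_add v v' k x)
    (fun r v w => by
      rw [smul_eq_mul, ← inner_const_mul_left]
      congr 1
      ext k x
      exact Vh.val_smul r v k x)
    (fun v w w' => by
      rw [← M.inner_add_right (fun k => M.integrableOn_elem (v.continuous_val k) k)
        (w.continuous_partialDeriv i) (w'.continuous_partialDeriv i)]
      congr 1
      ext k x
      exact Vh.partialDeriv_add i w w' k x)
    (fun r v w => by
      rw [smul_eq_mul, ← inner_const_mul_right]
      congr 1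
      ext k x
      exact Vh.partialDeriv_smul i r w k x)

lemma inner_divergence (u : Vh K N) (w : Vh K N × Vh K N) :
    M.inner u.val (fun k x => w.1.partialDeriv 0 k x + w.2.partialDeriv 1 k x) =
      M.derivForm 0 u w.1 + M.derivForm 1 u w.2 :=
  M.inner_add_right (fun k => M.integrableOn_elem (u.continuous_val k) k)
    (w.1.continuous_partialDeriv 0) (w.2.continuous_partialDeriv 1)

/-- A form `(D v, w)` in which `D` acts linearly on `V_h`, with values integrable on `Ω`. -/
noncomputable def operatorForm (D : Vh K N → ℝ × ℝ → ℝ)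
    (hi : ∀ v, IntegrableOn (D v) (Set.Icc a b ×ˢ Set.Icc c d))
    (hadd : ∀ v w, ∀ x ∈ Set.Icc a b ×ˢ Set.Icc c d, D (v + w) x = D v x + D w x)
    (hsmul : ∀ (r : ℝ) v x, D (r • v) x = r * D v x) : Vh K N →ₗ[ℝ] Vh K N →ₗ[ℝ] ℝ :=
  LinearMap.mk₂ ℝ (fun v w => M.inner (fun _ => D v) w.val)
    (fun v v' w => by
      rw [← M.inner_add_left (fun k => (hi v).mono_set (M.elem_subset k))
        (fun k => (hi v').mono_set (M.elem_subset k)) w.continuous_val]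
      exact M.inner_congr_left (fun k x hx => hadd v v' x (M.elem_subset k hx)) _)
    (fun r v w => by
      rw [smul_eq_mul, ← inner_const_mul_left]
      exact M.inner_congr_left (fun k x _ => hsmul r v x) _)
    (fun v w w' => by
      rw [← M.inner_add_right (fun k => (hi v).mono_set (M.elem_subset k))
        w.continuous_val w'.continuous_val]
      congr 1
      ext k x
      exact Vh.val_add w w' k x)
    (fun r v w => by
      rw [smul_eq_mul, ← inner_const_mul_right]
      congr 1
      ext k x
      exact Vh.val_smul r w k x)

lemma fracIntX_eq (s : ℝ) (v : Vh K N) : M.fracIntX s v = fracFst a s (M.toFun v) := rfl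

lemma fracIntY_eq (s : ℝ) (v : Vh K N) :
    M.fracIntY s v = fracFst c s (M.toFun v ∘ Prod.swap) ∘ Prod.swap := rfl

section
variable {s : ℝ}

lemma integrableOn_fracIntX (hs0 : 0 ≤ s) (hs1 : s < 1) (v : Vh K N) :
    IntegrableOn (M.fracIntX s v) (Set.Icc a b ×ˢ Set.Icc c d) :=
  (M.boundedOnRect_toFun v).integrableOn_fracFst hs0 hs1

lemma integrableOn_fracIntY (hs0 : 0 ≤ s) (hs1 : s < 1) (v : Vh K N) :
    IntegrableOn (M.fracIntY s v) (Set.Icc a b ×ˢ Set.Icc c d) := by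
  have h := (M.boundedOnRect_toFun v).swap.integrableOn_fracFst hs0 hs1
  rw [← integrable_indicator_iff (measurableSet_Icc.prod measurableSet_Icc)] at h ⊢
  refine h.swap.congr (Filter.Eventually.of_forall fun x => ?_)
  simp only [Function.comp_apply, Set.indicator, Set.mem_prod, Prod.fst_swap, Prod.snd_swap,
    fracIntY_eq]
  split_ifs <;> first | rfl | (exfalso; tauto)

/-- The form `(∂_x^{-s} v, w)`. -/
noncomputable def fracFormX (hs0 : 0 ≤ s) (hs1 : s < 1) : Vh K N →ₗ[ℝ] Vh K N →ₗ[ℝ] ℝ :=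
  M.operatorForm (M.fracIntX s) (M.integrableOn_fracIntX hs0 hs1)
    (fun v w x hx => by
      have hadd := M.boundedOnRect_toFun (v + w)
      simp only [fracIntX_eq]
      have e : M.toFun (v + w) = fun x => M.toFun v x + M.toFun w x := funext (M.toFun_add v w)
      rw [e] at hadd ⊢
      exact (M.boundedOnRect_toFun v).fracFst_add (M.boundedOnRect_toFun w) hadd hs0 hs1 hx)
    (fun r v x => by
      have e : M.toFun (r • v) = fun x => r * M.toFun v x := funext (M.toFun_smul r v)
      rw [fracIntX_eq, e]
      exact BoundedOnRect.fracFst_const_mul r _ x)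

/-- The form `(∂_y^{-s} v, w)`. -/
noncomputable def fracFormY (hs0 : 0 ≤ s) (hs1 : s < 1) : Vh K N →ₗ[ℝ] Vh K N →ₗ[ℝ] ℝ :=
  M.operatorForm (M.fracIntY s) (M.integrableOn_fracIntY hs0 hs1)
    (fun v w x hx => by
      have hadd := (M.boundedOnRect_toFun (v + w)).swap
      simp only [fracIntY_eq, Function.comp_apply]
      have e : M.toFun (v + w) ∘ Prod.swap =
          fun x => (M.toFun v ∘ Prod.swap) x + (M.toFun w ∘ Prod.swap) x :=
        funext fun x => M.toFun_add v w x.swap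
      rw [e] at hadd ⊢
      exact (M.boundedOnRect_toFun v).swap.fracFst_add (M.boundedOnRect_toFun w).swap hadd hs0 hs1
        ⟨hx.2, hx.1⟩)
    (fun r v x => by
      have e : M.toFun (r • v) ∘ Prod.swap = fun x => r * (M.toFun v ∘ Prod.swap) x :=
        funext fun x => M.toFun_smul r v x.swap
      rw [fracIntY_eq, e]
      exact BoundedOnRect.fracFst_const_mul r _ x.swap)

lemma fracFormX_self (hs0 : 0 ≤ s) (hs1 : s < 1) (v : Vh K N) :
    0 ≤ M.fracFormX hs0 hs1 v v ∧
    ∫⁻ y in Set.Ioo c d, negSobolevNorm (s / 2) (fun x => M.toFun v (x, y)) ^ 2 =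
      ENNReal.ofReal (M.fracFormX hs0 hs1 v v / Real.cos (s * Real.pi / 2)) := by
  have e : M.fracFormX hs0 hs1 v v = ∫ x, fracFst a s (M.toFun v) x * M.toFun v x :=
    M.inner_val_eq_integral v (M.integrableOn_fracIntX hs0 hs1 v)
  rw [e]
  refine (M.boundedOnRect_toFun v).lintegral_negSobolevNorm_sq hs0 hs1 fun y => ?_
  refine M.ae_continuousAt_toFun_comp v (φ := fun x => (x, y)) (by fun_prop) ?_
  intro x x' p q hpq
  ext
  · simp
  · simp [← add_mul, hpq]

lemma fracFormY_self (hs0 : 0 ≤ s) (hs1 : s < 1) (v : Vh K N) :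
    0 ≤ M.fracFormY hs0 hs1 v v ∧
    ∫⁻ x in Set.Ioo a b, negSobolevNorm (s / 2) (fun y => M.toFun v (x, y)) ^ 2 =
      ENNReal.ofReal (M.fracFormY hs0 hs1 v v / Real.cos (s * Real.pi / 2)) := by
  have e : M.fracFormY hs0 hs1 v v = ∫ x, fracFst c s (M.toFun v ∘ Prod.swap) x *
      (M.toFun v ∘ Prod.swap) x := by
    refine (M.inner_val_eq_integral v (M.integrableOn_fracIntY hs0 hs1 v)).trans ?_
    exact integral_prod_swap (μ := (volume : Measure ℝ)) (ν := (volume : Measure ℝ))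
      (fun x => fracFst c s (M.toFun v ∘ Prod.swap) x * (M.toFun v ∘ Prod.swap) x)
  rw [e]
  refine (M.boundedOnRect_toFun v).swap.lintegral_negSobolevNorm_sq hs0 hs1 fun x => ?_
  refine M.ae_continuousAt_toFun_comp v (φ := fun y => (x, y)) (by fun_prop) ?_
  intro y y' p q hpq
  ext
  · simp [← add_mul, hpq]
  · simp

end

end Mesh

/-! ### Curves in a finite-dimensional space -/

section Curves
variable {E F : Type*} [AddCommGroup E] [Module ℝ E] [AddCommGroup F] [Module ℝ F]

/-- `v ∈ L²(0,T;E)` for a finite-dimensional `E`, tested by linear functionals. -/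
def WeakL2 (T : ℝ) (v : ℝ → E) : Prop :=
  ∀ l : E →ₗ[ℝ] ℝ, MemLp (fun t => l (v t)) 2 (volume.restrict (Set.Ioo 0 T))

/-- Absolute continuity on `[0,T]` of a curve in a finite-dimensional space, tested by linear
functionals. -/
def WeakAC (T : ℝ) (v : ℝ → E) : Prop :=
  ∀ l : E →ₗ[ℝ] ℝ, AbsolutelyContinuousOnInterval (fun t => l (v t)) 0 T

variable {T : ℝ} {v v' : ℝ → E} {w : ℝ → F}

lemma WeakL2.integrable (hv : WeakL2 T v) (l : E →ₗ[ℝ] ℝ) :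
    IntegrableOn (fun t => l (v t)) (Set.Ioo 0 T) :=
  (hv l).integrable (by norm_num)

lemma WeakL2.sub (hv : WeakL2 T v) (hv' : WeakL2 T v') : WeakL2 T fun t => v t - v' t := by
  intro l
  simpa using! (hv l).sub (hv' l)

lemma WeakAC.sub (hv : WeakAC T v) (hv' : WeakAC T v') : WeakAC T fun t => v t - v' t := by
  intro l
  simpa using! (hv l).sub (hv' l)

variable [FiniteDimensional ℝ E]

lemma functional_eq_sum (l : E →ₗ[ℝ] ℝ) (x : E) :
    l x = ∑ i, (Module.finBasis ℝ E).coord i x * l (Module.finBasis ℝ E i) := by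
  have h := congrArg l ((Module.finBasis ℝ E).sum_repr x)
  rw [map_sum] at h
  rw [← h]
  exact Finset.sum_congr rfl fun i _ => by rw [map_smul, smul_eq_mul, Module.Basis.coord_apply]

lemma bilin_eq_sum (B : E →ₗ[ℝ] F →ₗ[ℝ] ℝ) (x : E) (y : F) :
    B x y = ∑ i, (Module.finBasis ℝ E).coord i x * B (Module.finBasis ℝ E i) y :=
  functional_eq_sum (B.flip y) x

lemma WeakL2.integrable_bilin (hv : WeakL2 T v) (hw : WeakL2 T w) (B : E →ₗ[ℝ] F →ₗ[ℝ] ℝ) :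
    IntegrableOn (fun t => B (v t) (w t)) (Set.Ioo 0 T) := by
  rw [funext fun t => bilin_eq_sum B (v t) (w t)]
  exact integrable_finsetSum _ fun i _ =>
    (hv ((Module.finBasis ℝ E).coord i)).integrable_mul (hw (B (Module.finBasis ℝ E i)))

/-- The derivative of a curve, taken coordinatewise in a fixed basis; meaningful at almost every
time when the curve is absolutely continuous. -/
noncomputable def curveDeriv (v : ℝ → E) (t : ℝ) : E :=
  ∑ i, deriv (fun τ => (Module.finBasis ℝ E).coord i (v τ)) t • Module.finBasis ℝ E i

lemma WeakAC.hasDerivAt (hv : WeakAC T v) : ∀ᵐ t, t ∈ Set.uIcc 0 T →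
    ∀ l : E →ₗ[ℝ] ℝ, HasDerivAt (fun τ => l (v τ)) (l (curveDeriv v t)) t := by
  have h : ∀ᵐ t, ∀ i, t ∈ Set.uIcc 0 T →
      DifferentiableAt ℝ (fun τ => (Module.finBasis ℝ E).coord i (v τ)) t :=
    ae_all_iff.2 fun i => (hv ((Module.finBasis ℝ E).coord i)).ae_differentiableAt
  filter_upwards [h] with t ht htT l
  have h1 : ∀ i, HasDerivAt (fun τ => (Module.finBasis ℝ E).coord i (v τ) *
      l (Module.finBasis ℝ E i))
      (deriv (fun τ => (Module.finBasis ℝ E).coord i (v τ)) t * l (Module.finBasis ℝ E i)) t :=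
    fun i => (ht i htT).hasDerivAt.mul_const _
  have h2 := HasDerivAt.fun_sum (u := Finset.univ) fun i _ => h1 i
  simp only [← functional_eq_sum] at h2
  convert! h2 using 1
  simp [curveDeriv]

lemma weakL2_curveDeriv (h : ∀ i, MemLp (deriv fun τ => (Module.finBasis ℝ E).coord i (v τ)) 2
    (volume.restrict (Set.Ioo 0 T))) : WeakL2 T (curveDeriv v) := by
  intro l
  simp only [curveDeriv, map_sum, map_smul, smul_eq_mul]
  exact memLp_finsetSum _ fun i _ => (h i).mul_const _

lemma _root_.AbsolutelyContinuousOnInterval.fun_sum {ι : Type*} (s : Finset ι) {f : ι → ℝ → ℝ}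
    {x y : ℝ} (hf : ∀ i ∈ s, AbsolutelyContinuousOnInterval (f i) x y) :
    AbsolutelyContinuousOnInterval (fun t => ∑ i ∈ s, f i t) x y := by
  classical
  induction s using Finset.induction_on with
  | empty =>
    simp only [Finset.sum_empty]
    exact (LipschitzWith.const (0 : ℝ)).lipschitzOnWith.absolutelyContinuousOnInterval
  | insert i s hi ih =>
    simp only [Finset.sum_insert hi]
    exact (hf i (Finset.mem_insert_self i s)).add
      (ih fun j hj => hf j (Finset.mem_insert_of_mem hj))

lemma WeakAC.bilin (hv : WeakAC T v) (B : E →ₗ[ℝ] E →ₗ[ℝ] ℝ) :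
    AbsolutelyContinuousOnInterval (fun t => B (v t) (v t)) 0 T := by
  rw [funext fun t => bilin_eq_sum B (v t) (v t)]
  exact AbsolutelyContinuousOnInterval.fun_sum _ fun i _ =>
    (hv ((Module.finBasis ℝ E).coord i)).mul (hv (B (Module.finBasis ℝ E i)))

lemma hasDerivAt_bilin {t : ℝ} {x : E}
    (h : ∀ l : E →ₗ[ℝ] ℝ, HasDerivAt (fun τ => l (v τ)) (l x) t) (B : E →ₗ[ℝ] E →ₗ[ℝ] ℝ) :
    HasDerivAt (fun τ => B (v τ) (v τ)) (B x (v t) + B (v t) x) t := by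
  have h1 := HasDerivAt.fun_sum (u := Finset.univ) fun i _ =>
    (h ((Module.finBasis ℝ E).coord i)).mul (h (B (Module.finBasis ℝ E i)))
  convert! h1 using 1
  · ext τ
    exact bilin_eq_sum B _ _
  · rw [Finset.sum_add_distrib, ← bilin_eq_sum, ← bilin_eq_sum]

end Curves

/-! ### Time-dependent elements of `V_h` -/

section
variable {K N : ℕ} {T : ℝ}

/-- A coefficient of one of the polynomials that make up `v ∈ V_h`. -/
noncomputable def coeffFunctional (km : Fin K × (Fin 2 →₀ ℕ)) : Vh K N →ₗ[ℝ] ℝ :=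
  MvPolynomial.lcoeff ℝ km.2 ∘ₗ Submodule.subtype _ ∘ₗ LinearMap.proj km.1

/-- The coefficients separate points, so they span the dual of `V_h`. -/
lemma mem_span_coeffFunctional (l : Vh K N →ₗ[ℝ] ℝ) :
    l ∈ Submodule.span ℝ (Set.range (coeffFunctional (K := K) (N := N))) := by
  apply FiniteDimensional.mem_span_of_iInf_ker_le_ker
  intro v hv
  have : v = 0 := by
    ext k m
    have := (Submodule.mem_iInf _).1 hv (k, m)
    simpa [coeffFunctional, MvPolynomial.lcoeff] using this
  rw [this]
  exact Submodule.zero_mem _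

lemma MemL2Vh.weakL2 {v : ℝ → Vh K N} (hv : MemL2Vh T v) : WeakL2 T v := by
  intro l
  induction mem_span_coeffFunctional l using Submodule.span_induction with
  | mem l hl =>
    obtain ⟨⟨k, m⟩, rfl⟩ := hl
    exact hv k m
  | zero => simp
  | add l l' _ _ h h' => simpa using! h.add h'
  | smul r l _ h => simpa using! h.const_mul r

lemma MemH1Vh.weakAC_and_deriv {v : ℝ → Vh K N} (hT : 0 ≤ T) (hv : MemH1Vh T v)
    (l : Vh K N →ₗ[ℝ] ℝ) : AbsolutelyContinuousOnInterval (fun t => l (v t)) 0 T ∧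
      MemLp (deriv fun t => l (v t)) 2 (volume.restrict (Set.Ioo 0 T)) := by
  induction mem_span_coeffFunctional l using Submodule.span_induction with
  | mem l hl =>
    obtain ⟨⟨k, m⟩, rfl⟩ := hl
    exact hv k m
  | zero =>
    simp only [LinearMap.zero_apply, deriv_const']
    exact ⟨(LipschitzWith.const (0 : ℝ)).lipschitzOnWith.absolutelyContinuousOnInterval, by simp⟩
  | add l l' _ _ h h' =>
    refine ⟨h.1.add h'.1, (h.2.add h'.2).ae_eq ?_⟩
    have h1 := h.1.ae_differentiableAt
    have h2 := h'.1.ae_differentiableAt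
    rw [Filter.EventuallyEq, ae_restrict_iff' measurableSet_Ioo]
    filter_upwards [h1, h2] with t h1 h2 ht
    have ht' : t ∈ Set.uIcc 0 T := by
      rw [Set.uIcc_of_le hT]
      exact Set.Ioo_subset_Icc_self ht
    exact (deriv_add (h1 ht') (h2 ht')).symm
  | smul r l _ h =>
    refine ⟨h.1.const_mul r, ?_⟩
    have : (deriv fun t => (r • l) (v t)) = fun t => r * deriv (fun t => l (v t)) t := by
      ext t
      exact deriv_const_mul_field r
    rw [this]
    exact h.2.const_mul r

lemma MemH1Vh.weakAC {v : ℝ → Vh K N} (hT : 0 ≤ T) (hv : MemH1Vh T v) : WeakAC T v :=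
  fun l => (hv.weakAC_and_deriv hT l).1

lemma MemH1Vh.weakL2_curveDeriv {v : ℝ → Vh K N} (hT : 0 ≤ T) (hv : MemH1Vh T v) :
    WeakL2 T (curveDeriv v) :=
  LDG.weakL2_curveDeriv fun _ => (hv.weakAC_and_deriv hT _).2

lemma WeakAC.weakL2 {v : ℝ → Vh K N} (hT : 0 ≤ T) (hv : WeakAC T v) : WeakL2 T v := by
  intro l
  have hc := (hv l).continuousOn
  rw [Set.uIcc_of_le hT] at hc
  obtain ⟨C, hC⟩ := isCompact_Icc.exists_bound_of_continuousOn hc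
  refine MemLp.of_bound ((hc.mono Set.Ioo_subset_Icc_self).aestronglyMeasurable
    measurableSet_Ioo) C ?_
  filter_upwards [ae_restrict_mem measurableSet_Ioo] with t ht
  exact hC t (Set.Ioo_subset_Icc_self ht)

/-- The evaluation of `v ∈ V_h` at a point of an element, as a linear functional. -/
noncomputable def valFunctional (k : Fin K) (x : ℝ × ℝ) : Vh K N →ₗ[ℝ] ℝ where
  toFun v := v.val k x
  map_add' v w := Vh.val_add v w k x
  map_smul' r v := Vh.val_smul r v k x

lemma timeDeriv_eq {v : ℝ → Vh K N} {t : ℝ} {x : Vh K N}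
    (h : ∀ l : Vh K N →ₗ[ℝ] ℝ, HasDerivAt (fun τ => l (v τ)) (l x) t) :
    timeDeriv v t = x.val := by
  ext k y
  exact (h (valFunctional k y)).deriv

/-- Scalar multiples `ψ(t) v₀` with smooth compactly supported `ψ` are admissible test
functions. -/
lemma memH1Vh_smul {ψ : ℝ → ℝ} (hψ : ContDiff ℝ (⊤ : ℕ∞) ψ) (hc : HasCompactSupport ψ)
    (v₀ : Vh K N) : MemH1Vh T fun t => ψ t • v₀ := by
  intro k m
  have e : (fun t => MvPolynomial.coeff m ((ψ t • v₀) k : MvPolynomial (Fin 2) ℝ)) =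
      fun t => MvPolynomial.coeff m (v₀ k : MvPolynomial (Fin 2) ℝ) * ψ t := by
    ext t
    simp [mul_comm]
  rw [e]
  constructor
  · obtain ⟨C, hC⟩ := hψ.lipschitzWith_of_hasCompactSupport hc (by simp)
    exact hC.lipschitzOnWith.absolutelyContinuousOnInterval.const_mul _
  · have : (deriv fun t => MvPolynomial.coeff m (v₀ k : MvPolynomial (Fin 2) ℝ) * ψ t) =
        fun t => MvPolynomial.coeff m (v₀ k : MvPolynomial (Fin 2) ℝ) * deriv ψ t := by
      ext t
      exact deriv_const_mul_field _
    rw [this]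
    exact ((hψ.continuous_deriv (by simp)).memLp_of_hasCompactSupport hc.deriv).const_mul _

lemma memL2Vh_smul {ψ : ℝ → ℝ} (hψ : ContDiff ℝ (⊤ : ℕ∞) ψ) (hc : HasCompactSupport ψ)
    (v₀ : Vh K N) : MemL2Vh T fun t => ψ t • v₀ := by
  intro k m
  have e : (fun t => MvPolynomial.coeff m ((ψ t • v₀) k : MvPolynomial (Fin 2) ℝ)) =
      fun t => MvPolynomial.coeff m (v₀ k : MvPolynomial (Fin 2) ℝ) * ψ t := by
    ext t
    simp [mul_comm]
  rw [e]
  exact (hψ.continuous.memLp_of_hasCompactSupport hc).const_mul _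

end

/-! ### The scheme as a time integral of a functional of the test functions -/

namespace Mesh
variable {K N : ℕ} {a b c d : ℝ} (M : Mesh K a b c d)

lemma intInternal_add {g h : Fin K × Fin 3 → Fin K × Fin 3 → ℝ × ℝ → ℝ}
    (hg : ∀ e e', Continuous (g e e')) (hh : ∀ e e', Continuous (h e e')) :
    M.intInternal (fun e e' x => g e e' x + h e e' x) = M.intInternal g + M.intInternal h := by
  simp only [intInternal]
  rw [← mul_add, ← Finset.sum_add_distrib]
  congr 1
  exact Finset.sum_congr rfl fun p _ => M.sideInt_add _ (hg _ _) (hh _ _)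

lemma intInternal_const_mul (r : ℝ) (g : Fin K × Fin 3 → Fin K × Fin 3 → ℝ × ℝ → ℝ) :
    M.intInternal (fun e e' x => r * g e e' x) = r * M.intInternal g := by
  simp only [intInternal, sideInt_const_mul, ← Finset.mul_sum]
  ring

/-- The central flux term `∮_{Γ_i} û [w] ds` as a bilinear form. -/
noncomputable def fluxFormU : Vh K N →ₗ[ℝ] (Vh K N × Vh K N) →ₗ[ℝ] ℝ :=
  LinearMap.mk₂ ℝ M.fluxTermU
    (fun u u' w => by
      rw [fluxTermU, fluxTermU, fluxTermU, ← M.intInternal_add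
        (fun e e' => M.continuous_fluxU_jumpVec u w e e')
        (fun e e' => M.continuous_fluxU_jumpVec u' w e e')]
      congr 1
      ext e e' x
      simp only [fluxU, Vh.val_add]
      ring)
    (fun r u w => by
      rw [fluxTermU, fluxTermU, smul_eq_mul, ← intInternal_const_mul]
      congr 1
      ext e e' x
      simp only [fluxU, Vh.val_smul]
      ring)
    (fun u w w' => by
      rw [fluxTermU, fluxTermU, fluxTermU, ← M.intInternal_add
        (fun e e' => M.continuous_fluxU_jumpVec u w e e')
        (fun e e' => M.continuous_fluxU_jumpVec u w' e e')]
      congr 1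
      ext e e' x
      simp only [jumpVec, trace, dot, Prod.fst_add, Prod.snd_add, Vh.val_add]
      ring)
    (fun r u w => by
      rw [fluxTermU, fluxTermU, smul_eq_mul, ← intInternal_const_mul]
      congr 1
      ext e e' x
      simp only [jumpVec, trace, dot, Prod.smul_fst, Prod.smul_snd, Vh.val_smul]
      ring)

/-- The remaining flux term is linear in both arguments as well, by elementwise integration by
parts. -/
lemma fluxTermQ_eq (q : Vh K N × Vh K N) (v : Vh K N) :
    M.fluxTermQ q v = M.derivForm 0 q.1 v + M.derivForm 1 q.2 v +
      (M.derivForm 0 v q.1 + M.derivForm 1 v q.2) - M.fluxFormU v q := by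
  rw [← inner_divergence]
  exact eq_sub_of_add_eq (M.fluxTermQ_add_fluxTermU v q)

section
variable {s r : ℝ} (hs0 : 0 ≤ s) (hs1 : s < 1) (hr0 : 0 ≤ r) (hr1 : r < 1)

/-- The scheme at a fixed time as a functional of the test functions `(v, φ, π)`; `u'` stands for
the time derivative.  By elementwise integration by parts, `(q, ∇v) - ∮_Γ q̂ · [v] ds` is written as
`-(v, ∇·q) + ∮_{Γ_i} v̂ [q] ds`, which is visibly bilinear. -/
noncomputable def residual (u' u : Vh K N) (p q : Vh K N × Vh K N) :
    (Vh K N × (Vh K N × Vh K N) × (Vh K N × Vh K N)) →ₗ[ℝ] ℝ :=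
  (M.massForm u' - (M.derivForm 0).flip q.1 - (M.derivForm 1).flip q.2 +
      M.fluxFormU.flip q).coprod
    (((M.massForm q.1 - M.fracFormX hs0 hs1 p.1).coprod
        (M.massForm q.2 - M.fracFormY hr0 hr1 p.2)).coprod
      ((M.massForm p.1 + M.derivForm 0 u).coprod (M.massForm p.2 + M.derivForm 1 u) -
        M.fluxFormU u))

lemma residual_apply (u' u : Vh K N) (p q : Vh K N × Vh K N) (v : Vh K N)
    (φ π : Vh K N × Vh K N) :
    M.residual hs0 hs1 hr0 hr1 u' u p q (v, φ, π) =
      M.massForm u' v - M.derivForm 0 v q.1 - M.derivForm 1 v q.2 + M.fluxFormU v q +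
      (M.massForm q.1 φ.1 - M.fracFormX hs0 hs1 p.1 φ.1 +
        (M.massForm q.2 φ.2 - M.fracFormY hr0 hr1 p.2 φ.2) +
      (M.massForm p.1 π.1 + M.derivForm 0 u π.1 + (M.massForm p.2 π.2 + M.derivForm 1 u π.2) -
        M.fluxFormU u π)) := rfl

lemma residual_sub (u' u : Vh K N) (p q : Vh K N × Vh K N) (v' v : Vh K N)
    (p' q' : Vh K N × Vh K N) (W : Vh K N × (Vh K N × Vh K N) × (Vh K N × Vh K N)) :
    M.residual hs0 hs1 hr0 hr1 (u' - v') (u - v) (p.1 - p'.1, p.2 - p'.2)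
        (q.1 - q'.1, q.2 - q'.2) W =
      M.residual hs0 hs1 hr0 hr1 u' u p q W - M.residual hs0 hs1 hr0 hr1 v' v p' q' W := by
  obtain ⟨w, φ, π⟩ := W
  have hq : ((q.1 - q'.1, q.2 - q'.2) : Vh K N × Vh K N) = q - q' := rfl
  rw [residual_apply, residual_apply, residual_apply, hq]
  simp only [map_sub, LinearMap.sub_apply, Prod.fst_sub, Prod.snd_sub]
  ring

/-- Testing the scheme with `(u, -p, q)`: all terms cancel except the energy terms. -/
lemma residual_energy (u' u : Vh K N) (p q : Vh K N × Vh K N) :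
    M.residual hs0 hs1 hr0 hr1 u' u p q (u, -p, q) =
      M.massForm u' u + M.fracFormX hs0 hs1 p.1 p.1 + M.fracFormY hr0 hr1 p.2 p.2 := by
  have hsymm : ∀ v w : Vh K N, M.massForm v w = M.massForm w v := fun v w => M.inner_comm _ _
  rw [residual_apply]
  simp only [Prod.fst_neg, Prod.snd_neg, map_neg]
  rw [hsymm p.1 q.1, hsymm p.2 q.2]
  ring

end

lemma massForm_self_nonneg (v : Vh K N) : 0 ≤ M.massForm v v :=
  show 0 ≤ M.inner v.val v.val from Finset.sum_nonneg fun _ _ => integral_nonneg fun _ => mul_self_nonneg _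

lemma normL2_sq (v : Vh K N) : M.normL2 v ^ 2 = M.massForm v v :=
  Real.sq_sqrt (M.massForm_self_nonneg v)

end Mesh

section
variable {K N : ℕ} {a b c d : ℝ} {M : Mesh K a b c d} {α β T : ℝ}

lemma WeakL2.prod {w : ℝ → Vh K N × Vh K N} (hw : WeakL2 T fun t => (w t).1)
    (hw' : WeakL2 T fun t => (w t).2) : WeakL2 T w := by
  intro l
  have h1 := hw (l ∘ₗ LinearMap.inl ℝ _ _)
  have h2 := hw' (l ∘ₗ LinearMap.inr ℝ _ _)
  have e : (fun t => l (w t)) = (fun t => (l ∘ₗ LinearMap.inl ℝ _ _) (w t).1) +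
      fun t => (l ∘ₗ LinearMap.inr ℝ _ _) (w t).2 := by
    ext t
    simp [← map_add]
  rw [e]
  exact h1.add h2

lemma integrable_residual {s r : ℝ} (hs0 : 0 ≤ s) (hs1 : s < 1) (hr0 : 0 ≤ r) (hr1 : r < 1)
    {u' u : ℝ → Vh K N} {p q : ℝ → Vh K N × Vh K N} (hu' : WeakL2 T u') (hu : WeakL2 T u)
    (hp : MemL2Vh2 T p) (hq : MemL2Vh2 T q)
    (W : Vh K N × (Vh K N × Vh K N) × (Vh K N × Vh K N)) :
    IntegrableOn (fun t => M.residual hs0 hs1 hr0 hr1 (u' t) (u t) (p t) (q t) W)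
      (Set.Ioo 0 T) := by
  obtain ⟨v, φ, π⟩ := W
  have hp1 := hp.1.weakL2
  have hp2 := hp.2.weakL2
  have hq1 := hq.1.weakL2
  have hq2 := hq.2.weakL2
  have hq12 : WeakL2 T q := hq1.prod hq2
  simp only [Mesh.residual_apply]
  refine ((((hu'.integrable (M.massForm.flip v)).sub (hq1.integrable (M.derivForm 0 v))).sub
    (hq2.integrable (M.derivForm 1 v))).add (hq12.integrable (M.fluxFormU v))).add
    ((((hq1.integrable (M.massForm.flip φ.1)).sub
      (hp1.integrable ((M.fracFormX hs0 hs1).flip φ.1))).add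
      ((hq2.integrable (M.massForm.flip φ.2)).sub
      (hp2.integrable ((M.fracFormY hr0 hr1).flip φ.2)))).add
    ((((hp1.integrable (M.massForm.flip π.1)).add
      (hu.integrable ((M.derivForm 0).flip π.1))).add
      ((hp2.integrable (M.massForm.flip π.2)).add
      (hu.integrable ((M.derivForm 1).flip π.2)))).sub
      (hu.integrable (M.fluxFormU.flip π))))

/-- The form `B` on test functions `ψ(t) (v, φ, π)` is the time integral of the residual. -/
lemma formB_smul (hT : 0 ≤ T) (hs0 : 0 ≤ 2 - α) (hs1 : 2 - α < 1) (hr0 : 0 ≤ 2 - β)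
    (hr1 : 2 - β < 1) {u : ℝ → Vh K N} {p q : ℝ → Vh K N × Vh K N} (hu : MemH1Vh T u)
    (hp : MemL2Vh2 T p) (hq : MemL2Vh2 T q) {ψ : ℝ → ℝ} (hψ : Continuous ψ)
    (hc : HasCompactSupport ψ) (v : Vh K N) (φ π : Vh K N × Vh K N) :
    M.formB α β T u p q (fun t => ψ t • v) (fun t => ψ t • φ) (fun t => ψ t • π) =
      ∫ t in Set.Ioo 0 T,
        ψ t * M.residual hs0 hs1 hr0 hr1 (curveDeriv u t) (u t) (p t) (q t) (v, φ, π) := by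
  have hu' := hu.weakL2_curveDeriv hT
  have hu2 := (hu.weakAC hT).weakL2 hT
  have hp1 := hp.1.weakL2
  have hp2 := hp.2.weakL2
  have hq1 := hq.1.weakL2
  have hq2 := hq.2.weakL2
  have hq12 : WeakL2 T q := hq1.prod hq2
  obtain ⟨C, hC⟩ := hc.exists_bound_of_continuous hψ
  have hbdd : ∀ {f : ℝ → ℝ}, IntegrableOn f (Set.Ioo 0 T) →
      IntegrableOn (fun t => ψ t * f t) (Set.Ioo 0 T) := fun hf =>
    hf.bdd_mul hψ.aestronglyMeasurable (Filter.Eventually.of_forall hC)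
  have i1 : ∫ t in Set.Ioo 0 T, M.inner (timeDeriv u t) (ψ t • v).val =
      ∫ t in Set.Ioo 0 T, ψ t * M.massForm (curveDeriv u t) v := by
    apply integral_congr_ae
    rw [Filter.EventuallyEq, ae_restrict_iff' measurableSet_Ioo]
    filter_upwards [(hu.weakAC hT).hasDerivAt] with t ht htT
    have htT' : t ∈ Set.uIcc 0 T := by
      rw [Set.uIcc_of_le hT]
      exact Set.Ioo_subset_Icc_self htT
    rw [timeDeriv_eq (ht htT')]
    exact (M.massForm (curveDeriv u t)).map_smul (ψ t) v
  have i2 : ∀ t, M.inner (q t).1.val ((ψ t • v).partialDeriv 0) +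
        M.inner (q t).2.val ((ψ t • v).partialDeriv 1) =
      ψ t * (M.derivForm 0 (q t).1 v + M.derivForm 1 (q t).2 v) := fun t => by
    rw [mul_add]
    exact congrArg₂ _ ((M.derivForm 0 (q t).1).map_smul (ψ t) v)
      ((M.derivForm 1 (q t).2).map_smul (ψ t) v)
  have i3 : ∀ w : ℝ → Vh K N × Vh K N, ∀ ρ : Vh K N × Vh K N, ∀ t,
      M.inner (w t).1.val (ψ t • ρ).1.val + M.inner (w t).2.val (ψ t • ρ).2.val =
      ψ t * (M.massForm (w t).1 ρ.1 + M.massForm (w t).2 ρ.2) := fun w ρ t => by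
    rw [mul_add]
    exact congrArg₂ _ ((M.massForm (w t).1).map_smul (ψ t) ρ.1)
      ((M.massForm (w t).2).map_smul (ψ t) ρ.2)
  have i4 : ∀ t, M.inner (fun _ => M.fracIntX (2 - α) (p t).1) (ψ t • φ).1.val +
        M.inner (fun _ => M.fracIntY (2 - β) (p t).2) (ψ t • φ).2.val =
      ψ t * (M.fracFormX hs0 hs1 (p t).1 φ.1 + M.fracFormY hr0 hr1 (p t).2 φ.2) := fun t => by
    rw [mul_add]
    exact congrArg₂ _ ((M.fracFormX hs0 hs1 (p t).1).map_smul (ψ t) φ.1)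
      ((M.fracFormY hr0 hr1 (p t).2).map_smul (ψ t) φ.2)
  have i5 : ∀ t, M.inner (u t).val
        (fun k x => (ψ t • π).1.partialDeriv 0 k x + (ψ t • π).2.partialDeriv 1 k x) =
      ψ t * (M.derivForm 0 (u t) π.1 + M.derivForm 1 (u t) π.2) := fun t => by
    rw [M.inner_divergence, Prod.smul_fst, Prod.smul_snd, map_smul, map_smul, smul_eq_mul,
      smul_eq_mul, mul_add]
  have i6 : ∀ t, M.fluxTermQ (q t) (ψ t • v) + M.fluxTermU (u t) (ψ t • π) =
      ψ t * (M.derivForm 0 (q t).1 v + M.derivForm 1 (q t).2 v +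
        (M.derivForm 0 v (q t).1 + M.derivForm 1 v (q t).2) - M.fluxFormU v (q t) +
        M.fluxFormU (u t) π) := fun t => by
    have e : M.fluxTermU (u t) (ψ t • π) = ψ t * M.fluxFormU (u t) π :=
      (M.fluxFormU (u t)).map_smul (ψ t) π
    rw [Mesh.fluxTermQ_eq, e]
    simp only [map_smul, LinearMap.smul_apply, smul_eq_mul]
    ring
  rw [Mesh.formB]
  simp only [intervalIntegral.integral_of_le hT, integral_Ioc_eq_integral_Ioo]
  rw [i1]
  simp only [i2, i3, i4, i5, i6]
  have j1 := hbdd (hu'.integrable (M.massForm.flip v))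
  have j2 := hbdd ((hq1.integrable ((M.derivForm 0).flip v)).add
    (hq2.integrable ((M.derivForm 1).flip v)))
  have j3 := hbdd ((hq1.integrable (M.massForm.flip φ.1)).add
    (hq2.integrable (M.massForm.flip φ.2)))
  have j4 := hbdd ((hp1.integrable ((M.fracFormX hs0 hs1).flip φ.1)).add
    (hp2.integrable ((M.fracFormY hr0 hr1).flip φ.2)))
  have j5 := hbdd ((hp1.integrable (M.massForm.flip π.1)).add
    (hp2.integrable (M.massForm.flip π.2)))
  have j6 := hbdd ((hu2.integrable ((M.derivForm 0).flip π.1)).add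
    (hu2.integrable ((M.derivForm 1).flip π.2)))
  have j7 := hbdd (((((hq1.integrable ((M.derivForm 0).flip v)).add
    (hq2.integrable ((M.derivForm 1).flip v))).add ((hq1.integrable (M.derivForm 0 v)).add
    (hq2.integrable (M.derivForm 1 v)))).sub (hq12.integrable (M.fluxFormU v))).add
    (hu2.integrable (M.fluxFormU.flip π)))
  -- linearity of the integral, from the outermost difference inwards
  refine Eq.trans (Eq.symm ((integral_sub (((((j1.add j2).add j3).sub j4).add j5).add j6) j7).trans
    (congrArg₂ _ ((integral_add ((((j1.add j2).add j3).sub j4).add j5) j6).trans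
    (congrArg₂ _ ((integral_add (((j1.add j2).add j3).sub j4) j5).trans
    (congrArg₂ _ ((integral_sub ((j1.add j2).add j3) j4).trans
    (congrArg₂ _ ((integral_add (j1.add j2) j3).trans
    (congrArg₂ _ (integral_add j1 j2) rfl)) rfl)) rfl)) rfl)) rfl))) ?_
  congr 1
  ext t
  simp only [Pi.add_apply, Pi.sub_apply, LinearMap.flip_apply, Mesh.residual_apply]
  ring

end

/-! ### The energy identity -/

section
variable {K N : ℕ} {a b c d : ℝ} {M : Mesh K a b c d} {α β T : ℝ}

/-- The difference of two solutions satisfies the homogeneous scheme at almost every time. -/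
lemma ae_residual_eq_zero (hT : 0 ≤ T) (hs0 : 0 ≤ 2 - α) (hs1 : 2 - α < 1) (hr0 : 0 ≤ 2 - β)
    (hr1 : 2 - β < 1) {f : ℝ × ℝ → ℝ → ℝ} {u u' : ℝ → Vh K N} {p q p' q' : ℝ → Vh K N × Vh K N}
    (h : M.IsSolution α β T f u p q) (h' : M.IsSolution α β T f u' p' q') :
    ∀ᵐ t, t ∈ Set.Ioo 0 T → M.residual hs0 hs1 hr0 hr1 (curveDeriv u t - curveDeriv u' t)
      (u t - u' t) ((p t).1 - (p' t).1, (p t).2 - (p' t).2)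
      ((q t).1 - (q' t).1, (q t).2 - (q' t).2) = 0 := by
  -- a finite basis leaves a single null set of times that serves all test functions
  let W := Module.finBasis ℝ (Vh K N × (Vh K N × Vh K N) × (Vh K N × Vh K N))
  have key : ∀ i, ∀ᵐ t, t ∈ Set.Ioo 0 T →
      M.residual hs0 hs1 hr0 hr1 (curveDeriv u t) (u t) (p t) (q t) (W i) -
        M.residual hs0 hs1 hr0 hr1 (curveDeriv u' t) (u' t) (p' t) (q' t) (W i) = 0 := by
    intro i
    have hi := integrable_residual (M := M) hs0 hs1 hr0 hr1 (h.memU.weakL2_curveDeriv hT)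
      ((h.memU.weakAC hT).weakL2 hT) h.memP h.memQ (W i)
    have hi' := integrable_residual (M := M) hs0 hs1 hr0 hr1 (h'.memU.weakL2_curveDeriv hT)
      ((h'.memU.weakAC hT).weakL2 hT) h'.memP h'.memQ (W i)
    refine isOpen_Ioo.ae_eq_zero_of_integral_contDiff_smul_eq_zero
      (hi.sub hi').locallyIntegrableOn fun ψ hψ hc hsupp => ?_
    obtain ⟨C, hC⟩ := hc.exists_bound_of_continuous hψ.continuous
    have hbdd : ∀ {f : ℝ → ℝ}, IntegrableOn f (Set.Ioo 0 T) →
        IntegrableOn (fun t => ψ t * f t) (Set.Ioo 0 T) := fun hf =>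
      hf.bdd_mul hψ.continuous.aestronglyMeasurable (Filter.Eventually.of_forall hC)
    have e1 := h.equation (fun t => ψ t • (W i).1) (fun t => ψ t • (W i).2.1)
      (fun t => ψ t • (W i).2.2) (memH1Vh_smul hψ hc _)
      ⟨memL2Vh_smul hψ hc _, memL2Vh_smul hψ hc _⟩ ⟨memL2Vh_smul hψ hc _, memL2Vh_smul hψ hc _⟩
    have e2 := h'.equation (fun t => ψ t • (W i).1) (fun t => ψ t • (W i).2.1)
      (fun t => ψ t • (W i).2.2) (memH1Vh_smul hψ hc _)
      ⟨memL2Vh_smul hψ hc _, memL2Vh_smul hψ hc _⟩ ⟨memL2Vh_smul hψ hc _, memL2Vh_smul hψ hc _⟩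
    rw [← e2, formB_smul hT hs0 hs1 hr0 hr1 h.memU h.memP h.memQ hψ.continuous hc,
      formB_smul hT hs0 hs1 hr0 hr1 h'.memU h'.memP h'.memQ hψ.continuous hc] at e1
    rw [← setIntegral_eq_integral_of_forall_compl_eq_zero (s := Set.Ioo 0 T)]
    · simp only [smul_eq_mul, mul_sub]
      exact (integral_sub (hbdd hi) (hbdd hi')).trans (sub_eq_zero.2 e1)
    · intro t ht
      rw [image_eq_zero_of_notMem_tsupport fun h => ht (hsupp h), zero_smul]
  filter_upwards [ae_all_iff.2 key] with t ht htT
  refine W.ext fun i => ?_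
  rw [M.residual_sub]
  exact ht i htT

/-- The energy identity for the difference of two solutions. -/
lemma massForm_sub_eq (hs0 : 0 ≤ 2 - α) (hs1 : 2 - α < 1) (hr0 : 0 ≤ 2 - β)
    (hr1 : 2 - β < 1) {f : ℝ × ℝ → ℝ → ℝ} {u u' : ℝ → Vh K N} {p q p' q' : ℝ → Vh K N × Vh K N}
    (h : M.IsSolution α β T f u p q) (h' : M.IsSolution α β T f u' p' q') {t : ℝ}
    (ht : t ∈ Set.Ioo 0 T) :
    M.massForm (u t - u' t) (u t - u' t) = M.massForm (u 0 - u' 0) (u 0 - u' 0) -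
      2 * (∫ τ in Set.Ioo 0 t,
        M.fracFormX hs0 hs1 ((p τ).1 - (p' τ).1) ((p τ).1 - (p' τ).1)) -
      2 * ∫ τ in Set.Ioo 0 t,
        M.fracFormY hr0 hr1 ((p τ).2 - (p' τ).2) ((p τ).2 - (p' τ).2) := by
  have hT : 0 ≤ T := (ht.1.trans ht.2).le
  have hsub : Set.Ioo 0 t ⊆ Set.Ioo 0 T := Set.Ioo_subset_Ioo_right ht.2.le
  have hac := (h.memU.weakAC hT).sub (h'.memU.weakAC hT)
  have hE := (hac.bilin M.massForm).mono (c := 0) (d := t) (by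
    rw [Set.uIcc_of_le hT, Set.uIcc_of_le ht.1.le]
    exact Set.Icc_subset_Icc_right ht.2.le)
  have hX : IntegrableOn (fun τ => M.fracFormX hs0 hs1 ((p τ).1 - (p' τ).1)
      ((p τ).1 - (p' τ).1)) (Set.Ioo 0 t) :=
    IntegrableOn.mono_set ((h.memP.1.weakL2.sub h'.memP.1.weakL2).integrable_bilin
      (h.memP.1.weakL2.sub h'.memP.1.weakL2) _) hsub
  have hY : IntegrableOn (fun τ => M.fracFormY hr0 hr1 ((p τ).2 - (p' τ).2)
      ((p τ).2 - (p' τ).2)) (Set.Ioo 0 t) :=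
    IntegrableOn.mono_set ((h.memP.2.weakL2.sub h'.memP.2.weakL2).integrable_bilin
      (h.memP.2.weakL2.sub h'.memP.2.weakL2) _) hsub
  have hftc := hE.integral_deriv_eq_sub
  rw [intervalIntegral.integral_of_le ht.1.le, integral_Ioc_eq_integral_Ioo] at hftc
  have hderiv : ∫ τ in Set.Ioo 0 t, deriv (fun τ => M.massForm (u τ - u' τ) (u τ - u' τ)) τ =
      ∫ τ in Set.Ioo 0 t, (-2 * M.fracFormX hs0 hs1 ((p τ).1 - (p' τ).1) ((p τ).1 - (p' τ).1) +
        -2 * M.fracFormY hr0 hr1 ((p τ).2 - (p' τ).2) ((p τ).2 - (p' τ).2)) := by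
    apply integral_congr_ae
    rw [Filter.EventuallyEq, ae_restrict_iff' measurableSet_Ioo]
    filter_upwards [ae_residual_eq_zero hT hs0 hs1 hr0 hr1 h h', (h.memU.weakAC hT).hasDerivAt,
      (h'.memU.weakAC hT).hasDerivAt] with τ h1 h2 h3 hτ
    have hτ' : τ ∈ Set.uIcc 0 T := by
      rw [Set.uIcc_of_le hT]
      exact Set.Ioo_subset_Icc_self (hsub hτ)
    have h4 : ∀ l : Vh K N →ₗ[ℝ] ℝ, HasDerivAt (fun τ => l (u τ - u' τ))
        (l (curveDeriv u τ - curveDeriv u' τ)) τ := by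
      intro l
      simp only [map_sub]
      exact (h2 hτ' l).sub (h3 hτ' l)
    rw [(hasDerivAt_bilin (v := fun τ => u τ - u' τ) h4 M.massForm).deriv]
    have h5 := M.residual_energy hs0 hs1 hr0 hr1 (curveDeriv u τ - curveDeriv u' τ) (u τ - u' τ)
      ((p τ).1 - (p' τ).1, (p τ).2 - (p' τ).2) ((q τ).1 - (q' τ).1, (q τ).2 - (q' τ).2)
    rw [h1 (hsub hτ), LinearMap.zero_apply] at h5
    have h6 : M.massForm (u τ - u' τ) (curveDeriv u τ - curveDeriv u' τ) =
        M.massForm (curveDeriv u τ - curveDeriv u' τ) (u τ - u' τ) := M.inner_comm _ _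
    rw [h6]
    linarith
  rw [hderiv, integral_add (hX.const_mul _) (hY.const_mul _), integral_const_mul,
    integral_const_mul] at hftc
  linarith

end

/-- Integration in time of a squared norm that is a multiple of a quadratic form. -/
lemma setLIntegral_ofReal_div {φ : ℝ → ℝ} {t k : ℝ} (hφ : IntegrableOn φ (Set.Ioo 0 t))
    (h0 : ∀ τ, 0 ≤ φ τ) (hk : 0 < k) :
    (∫⁻ τ in Set.Ioo 0 t, ENNReal.ofReal (φ τ / k)) ≠ ⊤ ∧
    k * (∫⁻ τ in Set.Ioo 0 t, ENNReal.ofReal (φ τ / k)).toReal = ∫ τ in Set.Ioo 0 t, φ τ := by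
  rw [← ofReal_integral_eq_lintegral_ofReal (hφ.div_const k)
    (Filter.Eventually.of_forall fun τ => div_nonneg (h0 τ) hk.le)]
  refine ⟨ENNReal.ofReal_ne_top, ?_⟩
  rw [ENNReal.toReal_ofReal (integral_nonneg fun τ => div_nonneg (h0 τ) hk.le), integral_div]
  field_simp

end LDG

theorem theorem4p1 {K N : ℕ} {a b c d : ℝ} (hab : a < b) (hcd : c < d)
    (M : LDG.Mesh K a b c d) (α β T : ℝ)
    (hα : α ∈ Set.Ioc (1 : ℝ) 2) (hβ : β ∈ Set.Ioc (1 : ℝ) 2)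
    (f : ℝ × ℝ → ℝ → ℝ)
    (u u' : ℝ → LDG.Vh K N) (p q p' q' : ℝ → LDG.Vh K N × LDG.Vh K N)
    (h : M.IsSolution α β T f u p q) (h' : M.IsSolution α β T f u' p' q')
    (t : ℝ) (ht : t ∈ Set.Ioo 0 T) :
    M.normL2 (u t - u' t) ≤ M.normL2 (u 0 - u' 0) ∧
    M.negNormSqX (1 - α / 2) t (fun τ => (p τ).1 - (p' τ).1) ≠ ⊤ ∧
    M.negNormSqY (1 - β / 2) t (fun τ => (p τ).2 - (p' τ).2) ≠ ⊤ ∧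
    M.normL2 (u t - u' t) ^ 2 =
      M.normL2 (u 0 - u' 0) ^ 2
        - 2 * Real.cos ((α / 2 - 1) * Real.pi) *
            (M.negNormSqX (1 - α / 2) t (fun τ => (p τ).1 - (p' τ).1)).toReal
        - 2 * Real.cos ((β / 2 - 1) * Real.pi) *
            (M.negNormSqY (1 - β / 2) t (fun τ => (p τ).2 - (p' τ).2)).toReal := by
  have hs0 : 0 ≤ 2 - α := by linarith [hα.2]
  have hs1 : 2 - α < 1 := by linarith [hα.1]
  have hr0 : 0 ≤ 2 - β := by linarith [hβ.2]
  have hr1 : 2 - β < 1 := by linarith [hβ.1]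
  have hsub : Set.Ioo 0 t ⊆ Set.Ioo 0 T := Set.Ioo_subset_Ioo_right ht.2.le
  have hcα := LDG.cos_half_pos hs0 hs1
  have hcβ := LDG.cos_half_pos hr0 hr1
  have eα : Real.cos ((α / 2 - 1) * Real.pi) = Real.cos ((2 - α) * Real.pi / 2) := by
    rw [← Real.cos_neg]
    congr 1
    ring
  have eβ : Real.cos ((β / 2 - 1) * Real.pi) = Real.cos ((2 - β) * Real.pi / 2) := by
    rw [← Real.cos_neg]
    congr 1
    ring
  have hP := h.memP.1.weakL2.sub h'.memP.1.weakL2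
  have hP2 := h.memP.2.weakL2.sub h'.memP.2.weakL2
  have hX : IntegrableOn (fun τ => M.fracFormX hs0 hs1 ((p τ).1 - (p' τ).1)
      ((p τ).1 - (p' τ).1)) (Set.Ioo 0 t) := IntegrableOn.mono_set (hP.integrable_bilin hP _) hsub
  have hY : IntegrableOn (fun τ => M.fracFormY hr0 hr1 ((p τ).2 - (p' τ).2)
      ((p τ).2 - (p' τ).2)) (Set.Ioo 0 t) := IntegrableOn.mono_set (hP2.integrable_bilin hP2 _) hsub
  have hXn := fun τ => (M.fracFormX_self hs0 hs1 ((p τ).1 - (p' τ).1)).1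
  have hYn := fun τ => (M.fracFormY_self hr0 hr1 ((p τ).2 - (p' τ).2)).1
  obtain ⟨fX, iX⟩ := LDG.setLIntegral_ofReal_div hX hXn hcα
  obtain ⟨fY, iY⟩ := LDG.setLIntegral_ofReal_div hY hYn hcβ
  have nX : M.negNormSqX (1 - α / 2) t (fun τ => (p τ).1 - (p' τ).1) =
      ∫⁻ τ in Set.Ioo 0 t, ENNReal.ofReal (M.fracFormX hs0 hs1 ((p τ).1 - (p' τ).1)
        ((p τ).1 - (p' τ).1) / Real.cos ((2 - α) * Real.pi / 2)) := by
    rw [LDG.Mesh.negNormSqX, show 1 - α / 2 = (2 - α) / 2 by ring]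
    exact MeasureTheory.lintegral_congr fun τ => (M.fracFormX_self hs0 hs1 _).2
  have nY : M.negNormSqY (1 - β / 2) t (fun τ => (p τ).2 - (p' τ).2) =
      ∫⁻ τ in Set.Ioo 0 t, ENNReal.ofReal (M.fracFormY hr0 hr1 ((p τ).2 - (p' τ).2)
        ((p τ).2 - (p' τ).2) / Real.cos ((2 - β) * Real.pi / 2)) := by
    rw [LDG.Mesh.negNormSqY, show 1 - β / 2 = (2 - β) / 2 by ring]
    exact MeasureTheory.lintegral_congr fun τ => (M.fracFormY_self hr0 hr1 _).2
  have hE := LDG.massForm_sub_eq hs0 hs1 hr0 hr1 h h' ht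
  rw [nX, nY, eα, eβ, M.normL2_sq, M.normL2_sq, mul_assoc, mul_assoc, iX, iY]
  refine ⟨Real.sqrt_le_sqrt ?_, fX, fY, hE⟩
  change M.massForm (u t - u' t) (u t - u' t) ≤ M.massForm (u 0 - u' 0) (u 0 - u' 0)
  have h1 : 0 ≤ ∫ τ in Set.Ioo 0 t, M.fracFormX hs0 hs1 ((p τ).1 - (p' τ).1)
    ((p τ).1 - (p' τ).1) := integral_nonneg hXn
  have h2 : 0 ≤ ∫ τ in Set.Ioo 0 t, M.fracFormY hr0 hr1 ((p τ).2 - (p' τ).2)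
    ((p τ).2 - (p' τ).2) := integral_nonneg hYn
  linarith
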